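/- **Graph classes.** Let $\alpha\ge 1$ be real. For a finite graph $A$ put $\delta_\alpha(A)=\alpha|V(A)|-|E(A)|$. For an induced subgraph $A\subseteq B$ write $A\leqslant_\alpha B$ if $\delta_\alpha(A)\le\delta_\alpha(C)$ for all $A\subseteq C\subseteq B$, and $A<_\alpha B$ if $\delta_\alpha(A)<\delta_\alpha(C)$ for all $A\subsetneq C\subseteq B$. Let $(\mathcal K,\sqsubseteq)$ be one of the following classes of finite graphs. 1. $(\mathcal K_\alpha^+,\leqslant_\alpha)$, where $\mathcal K_\alpha^+$ is the class of finite graphs $A$ with $\delta_\alpha(B)\ge 0$ for all $B\subseteq A$. 2. $(\mathcal K_\alpha^\mu,\leqslant_\alpha)$, where $\alpha$ is rational. For disjoint vertex sets $A,B$ of a graph, $B$ is $0$-algebraic over $A$ if $\delta_\alpha(A\cup B)=\delta_\alpha(A)$ and $\delta_\alpha(A\cup B_0)>\delta_\alpha(A)$ for all $\emptyset\ne B_0\subsetneq B$; it is $0$-minimally algebraic over $A$ if moreover it is not $0$-algebraic over any proper subset of $A$. Here $\mu$ is a finite-to-one function, with values in $\mathbb N$, on the isomorphism types of pairs $(A,B)$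 such that $A\cup B\in\mathcal K_\alpha^+$, $A\neq\emptyset$ and $B$ is $0$-minimally algebraic over $A$, and $\mu(A,B)\ge\delta_\alpha(A)$ always. $\mathcal K_\alpha^\mu$ consists of the graphs in $\mathcal K_\alpha^+$ that contain, for each such pair with $A$ inside the graph, at most $\mu(A,B)$ pairwise disjoint isomorphic copies of $B$ over $A$. 3. $(\mathcal K_\alpha^{\mathsf f},<_\alpha)$, where $\alpha>1$, $\mathsf f:\mathbb R^{\ge0}\to\mathbb R^{\ge0}$ is increasing and unbounded, and $\mathcal K_\alpha^{\mathsf f}$ is the class of all $A\in\mathcal K_\alpha^+$ with $\delta_\alpha(A')\ge\mathsf f(|A'|)$ for all $A'\subseteq A$. It is assumed that $\mathsf f$ is good, i.e. that $(\mathcal K_\alpha^{\mathsf f},<_\alpha)$ is a smooth class with the free-amalgamation property, and that $\mathcal K_\alpha^{\mathsf f}$ contains at least one graph with an edge. (A class of finite graphs that is closed under isomorphism and induced subgraphs and contains $\emptyset$, with a reflexive, transitive, isomorphism-invariant relation $\sqsubseteq$ between induced subgraphs and graphs of the class, is *smooth* if $\emptyset\sqsubseteq A$ always, if $A\subseteq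 B'\subseteq B$ and $A\sqsubseteq B$ imply $A\sqsubseteq B'$, and if $A_1,A_2\subseteq A$ and $A_1\sqsubseteq A$ imply $A_1\cap A_2\sqsubseteq A_2$. It has the *free-amalgamation property* if, whenever $A\sqsubseteq B$, $A\sqsubseteq C$ and $B\cap C=A$, the graph $B\cup C$ whose only edges are those of $B$ and of $C$ is in the class.) **Ordered generic structures.** Let $\mathfrak L^*$ be a finite relational language containing two distinct binary symbols $\mathfrak R$ and $\prec$. Let $\mathcal K_{\mathfrak L^*}$ be the class of all finite $\mathfrak L^*$-structures whose $\mathfrak R$-reduct is a graph in $\mathcal K$ and in which $\prec$ is a (strict) linear order. For $A\subseteq B$ let $A\sqsubseteq^*B$ mean that the $\mathfrak R$-reducts satisfy $A\sqsubseteq B$. For a finite substructure $A$ of a structure $N$, write $A\sqsubseteq^* N$ if $A\sqsubseteq^* B$ for all finite $B$ with $A\subseteq B\subseteq N$. A countable $\mathfrak L^*$-structure $\mathbf M_{\mathfrak L^*}$ is $(\mathcal K_{\mathfrak L^*},\sqsubseteq^*)$-*generic* if: its finite substructures are, up to isomorphism, exactly the members of $\mathcal K_{\mathfrak L^*}$;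 it is the union of a chain $A_0\sqsubseteq^*A_1\sqsubseteq^*\cdots$ of members of $\mathcal K_{\mathfrak L^*}$; and whenever $A\sqsubseteq^*\mathbf M_{\mathfrak L^*}$ is finite and $A\sqsubseteq^*B\in\mathcal K_{\mathfrak L^*}$, there is an embedding $\Gamma:B\to\mathbf M_{\mathfrak L^*}$ that is the identity on $A$ and satisfies $\Gamma[B]\sqsubseteq^*\mathbf M_{\mathfrak L^*}$. **Theorem.** Let $\mathbf M_{\mathfrak L^*}$ be a $(\mathcal K_{\mathfrak L^*},\sqsubseteq^*)$-generic structure, where $(\mathcal K,\sqsubseteq)$ is any of the classes 1–3. Then $G=\mathrm{Aut}(\mathbf M_{\mathfrak L^*})$, with the topology of pointwise convergence, is not extremely amenable: there is a continuous action of $G$ on a nonempty compact Hausdorff space without a fixed point. -/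

import Mathlib

open FirstOrder FirstOrder.Language
open scoped NNReal

/-! ### Extreme amenability -/

/-- A topological group is extremely amenable if every continuous action on a nonempty compact
Hausdorff space has a fixed point. -/
def IsExtremelyAmenable (G : Type) [Group G] [TopologicalSpace G] [IsTopologicalGroup G] : Prop :=
  ∀ (X : Type) [TopologicalSpace X] [CompactSpace X] [T2Space X] [Nonempty X]
    [MulAction G X] [ContinuousSMul G X], ∃ x : X, ∀ g : G, g • x = x

/-- The automorphism group of a first-order structure, as a group of permutations. -/
def autGroup (L : FirstOrder.Language.{0, 0}) (N : Type) [L.Structure N] : Subgroup (Equiv.Perm N) where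
  carrier := {σ | ∃ e : N ≃[L] N, e.toEquiv = σ}
  mul_mem' := by
    rintro _ _ ⟨e, rfl⟩ ⟨e', rfl⟩
    exact ⟨e.comp e', rfl⟩
  one_mem' := ⟨Language.Equiv.refl L N, rfl⟩
  inv_mem' := by
    rintro _ ⟨e, rfl⟩
    exact ⟨e.symm, rfl⟩

/-- The topology of pointwise convergence on the automorphism group: the one induced from `N → N`,
where `N` is discrete. -/
instance autGroup.instTopologicalSpace (L : FirstOrder.Language.{0, 0}) (N : Type) [L.Structure N] :
    TopologicalSpace (autGroup L N) :=
  TopologicalSpace.induced (fun g : autGroup L N => ((g : Equiv.Perm N) : N → N))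
    (@Pi.topologicalSpace N (fun _ => N) (fun _ => ⊥))

instance autGroup.instIsTopologicalGroup (L : FirstOrder.Language.{0, 0}) (N : Type) [L.Structure N] :
    IsTopologicalGroup (autGroup L N) := by
  let _ : TopologicalSpace N := ⊥
  have _ : DiscreteTopology N := ⟨rfl⟩
  have hind : Topology.IsInducing (fun g : autGroup L N => ((g : Equiv.Perm N) : N → N)) := ⟨rfl⟩
  have hev : ∀ x : N, Continuous (fun g : autGroup L N => (g : Equiv.Perm N) x) := fun x =>
    (continuous_apply x).comp hind.continuous
  have hopen : ∀ x y : N, IsOpen {g : autGroup L N | (g : Equiv.Perm N) x = y} := fun x y =>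
    (isOpen_discrete {y}).preimage (hev x)
  refine { continuous_mul := ?_, continuous_inv := ?_ }
  · refine hind.continuous_iff.2 (continuous_pi fun x => ?_)
    refine continuous_discrete_rng.2 fun z => isOpen_iff_forall_mem_open.2 ?_
    rintro ⟨g, h⟩ hgh
    refine ⟨{p | (p.1 : Equiv.Perm N) ((h : Equiv.Perm N) x) = z ∧
      (p.2 : Equiv.Perm N) x = (h : Equiv.Perm N) x}, ?_, ?_, ?_⟩
    · rintro ⟨p, q⟩ ⟨hp, hq⟩
      change (p : Equiv.Perm N) ((q : Equiv.Perm N) x) = z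
      rw [hq, hp]
    · exact ((hopen _ _).preimage continuous_fst).inter ((hopen _ _).preimage continuous_snd)
    · exact ⟨hgh, rfl⟩
  · refine hind.continuous_iff.2 (continuous_pi fun x => ?_)
    refine continuous_discrete_rng.2 fun z => ?_
    have : (fun g : autGroup L N => ((g⁻¹ : autGroup L N) : Equiv.Perm N) x) ⁻¹' {z} =
        {g : autGroup L N | (g : Equiv.Perm N) z = x} := by
      ext g
      simp only [Set.mem_preimage, Set.mem_singleton_iff, Set.mem_ofPred_eq, InvMemClass.coe_inv]
      rw [Equiv.Perm.inv_eq_iff_eq, eq_comm]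
    exact this ▸ hopen z x

/-! ### Classes of finite graphs with a notion of closed substructure -/

/-- The data of a class of graphs together with a relation `A ≤ G` between (the induced subgraph
on) a set `A` of vertices and a graph `G`. -/
structure GraphClass where
  /-- membership in the class -/
  mem : ∀ {V : Type}, SimpleGraph V → Prop
  /-- `le G A`: the induced subgraph on `A` is closed in `G` -/
  le : ∀ {V : Type}, SimpleGraph V → Set V → Prop

/-- `K` is a smooth class of finite graphs. -/
structure GraphClass.IsSmooth (K : GraphClass) : Prop where
  finite : ∀ {V : Type} {G : SimpleGraph V}, K.mem G → Finite V
  mem_iso : ∀ {V W : Type} {G : SimpleGraph V} {H : SimpleGraph W}, (G ≃g H) → K.mem G → K.mem H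
  mem_induce : ∀ {V : Type} {G : SimpleGraph V} (S : Set V), K.mem G → K.mem (G.induce S)
  le_iso : ∀ {V W : Type} {G : SimpleGraph V} {H : SimpleGraph W} (e : G ≃g H) (A : Set V),
    K.mem G → K.le G A → K.le H (e '' A)
  le_refl : ∀ {V : Type} {G : SimpleGraph V}, K.mem G → K.le G Set.univ
  le_trans : ∀ {V : Type} {G : SimpleGraph V} {A B : Set V}, K.mem G → A ⊆ B →
    K.le (G.induce B) {x | (x : V) ∈ A} → K.le G B → K.le G A
  empty_mem : K.mem (⊥ : SimpleGraph Empty)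
  empty_le : ∀ {V : Type} {G : SimpleGraph V}, K.mem G → K.le G ∅
  le_of_subset : ∀ {V : Type} {G : SimpleGraph V} {A B : Set V}, K.mem G → A ⊆ B →
    K.le G A → K.le (G.induce B) {x | (x : V) ∈ A}
  le_inter : ∀ {V : Type} {G : SimpleGraph V} {A₁ A₂ : Set V}, K.mem G →
    K.le G A₁ → K.le (G.induce A₂) {x | (x : V) ∈ A₁ ∩ A₂}

/-- The free amalgamation property: if `G` is the free amalgam of its induced subgraphs on `B` and
`C` over `B ∩ C`, these subgraphs are in the class and `B ∩ C` is closed in both, then `G` is in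
the class. -/
def GraphClass.FreeAmalgamation (K : GraphClass) : Prop :=
  ∀ {V : Type} (G : SimpleGraph V) (B C : Set V), B ∪ C = Set.univ →
    (∀ b ∈ B \ C, ∀ c ∈ C \ B, ¬ G.Adj b c) →
    K.mem (G.induce B) → K.mem (G.induce C) →
    K.le (G.induce B) {x | (x : V) ∈ C} → K.le (G.induce C) {x | (x : V) ∈ B} → K.mem G

/-! ### The ab-initio classes -/

/-- The predimension `δ_α(A) = α |V(A)| - |E(A)|` of the induced subgraph on a finite set `A`. -/
noncomputable def predim (α : ℝ) {V : Type} (G : SimpleGraph V) (A : Set V) : ℝ :=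
  α * (A.ncard : ℝ) - ((G.induce A).edgeSet.ncard : ℝ)

/-- `A ≤_α G`. -/
def LeAlpha (α : ℝ) {V : Type} (G : SimpleGraph V) (A : Set V) : Prop :=
  ∀ C : Set V, A ⊆ C → predim α G A ≤ predim α G C

/-- `A <_α G`. -/
def LtAlpha (α : ℝ) {V : Type} (G : SimpleGraph V) (A : Set V) : Prop :=
  ∀ C : Set V, A ⊂ C → predim α G A < predim α G C

/-- Membership in `K_α⁺`. -/
def MemPlus (α : ℝ) {V : Type} (G : SimpleGraph V) : Prop :=
  Finite V ∧ ∀ B : Set V, 0 ≤ predim α G B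

/-- The ab-initio class `(K_α⁺, ≤_α)`. -/
def abInitioClass (α : ℝ) : GraphClass where
  mem := MemPlus α
  le := LeAlpha α

/-- `B` is `0`-algebraic over `A`. -/
def IsZeroAlgebraic (α : ℝ) {V : Type} (G : SimpleGraph V) (A B : Set V) : Prop :=
  Disjoint A B ∧ predim α G (A ∪ B) - predim α G A = 0 ∧
    ∀ B₀ : Set V, B₀ ⊂ B → B₀.Nonempty → 0 < predim α G (A ∪ B₀) - predim α G A

/-- `B` is `0`-minimally algebraic over `A`. -/
def IsZeroMinAlgebraic (α : ℝ) {V : Type} (G : SimpleGraph V) (A B : Set V) : Prop :=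
  IsZeroAlgebraic α G A B ∧ ∀ A₀ : Set V, A₀ ⊂ A → ¬ IsZeroAlgebraic α G A₀ B

/-- The set `𝓔` of pairs `(A, B)` with `A` nonempty and `B` a `0`-minimally algebraic set over `A`.
A pair is given by the graph `H ∈ K_α⁺` on `A ∪ B` and its subset `A`, so that `B = Aᶜ`. -/
def IsMuPair (α : ℝ) {W : Type} (H : SimpleGraph W) (A : Set W) : Prop :=
  MemPlus α H ∧ A.Nonempty ∧ IsZeroMinAlgebraic α H A Aᶜ

/-- `μ` is a function on (isomorphism types of) pairs in `𝓔` which is finite-to-one and satisfies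
`μ(A, B) ≥ δ_α(A)`. The graphs on the sets `Fin n` represent every isomorphism type of finite
graphs at least once and at most finitely often. -/
structure IsMuFunction (α : ℝ) (μ : ∀ {W : Type}, SimpleGraph W → Set W → ℕ) : Prop where
  iso : ∀ {W W' : Type} {H : SimpleGraph W} {H' : SimpleGraph W'} (e : H ≃g H') (A : Set W),
    IsMuPair α H A → μ H' (e '' A) = μ H A
  predim_le : ∀ {W : Type} {H : SimpleGraph W} {A : Set W}, IsMuPair α H A →
    predim α H A ≤ (μ H A : ℝ)
  finite_to_one : ∀ k : ℕ,
    {p : Σ n : ℕ, SimpleGraph (Fin n) × Set (Fin n) |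
      IsMuPair α p.2.1 p.2.2 ∧ μ p.2.1 p.2.2 = k}.Finite

/-- `C` is an isomorphic copy of `B` over `A` in `G`. -/
def IsCopyOver {V : Type} (G : SimpleGraph V) (A B C : Set V) : Prop :=
  Disjoint A C ∧ ∃ e : G.induce (A ∪ B) ≃g G.induce (A ∪ C),
    ∀ (a : V) (ha : a ∈ A), (e ⟨a, Or.inl ha⟩ : V) = a

/-- The collapsed ab-initio class `(K_α^μ, ≤_α)`: for nonempty `A` and `B` a `0`-minimally algebraic
set over `A`, there are at most `μ(A, B)` pairwise disjoint copies of `B` over `A`. (It is enough to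
consider those `B` which have a copy over `A` in `G`, and then `B` may be taken inside `G`.) -/
def collapsedClass (α : ℝ) (μ : ∀ {W : Type}, SimpleGraph W → Set W → ℕ) : GraphClass where
  mem {V} G := MemPlus α G ∧ ∀ A B : Set V, A.Nonempty → IsZeroMinAlgebraic α G A B →
    ∀ 𝒞 : Set (Set V), 𝒞.PairwiseDisjoint id → (∀ C ∈ 𝒞, IsCopyOver G A B C) →
      𝒞.ncard ≤ μ (G.induce (A ∪ B)) {x | (x : V) ∈ A}
  le := LeAlpha α

/-- The class `(K_α^f, <_α)`. -/
def controlledClass (α : ℝ) (f : ℝ≥0 → ℝ≥0) : GraphClass where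
  mem {V} G := MemPlus α G ∧ ∀ A : Set V, (f (A.ncard : ℝ≥0) : ℝ) ≤ predim α G A
  le := LtAlpha α

/-- `f` is a good control function for `α`: it is increasing and unbounded, and `(K_α^f, <_α)` is a
smooth class with the free amalgamation property. -/
structure IsGood (α : ℝ) (f : ℝ≥0 → ℝ≥0) : Prop where
  monotone : Monotone f
  unbounded : ¬ BddAbove (Set.range f)
  smooth : (controlledClass α f).IsSmooth
  free : (controlledClass α f).FreeAmalgamation

/-- `f` is a nondegenerate good control function: moreover `α > 1`, and some graph in the class
`K_α^f` has an edge. -/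
structure IsNondegenerateGood (α : ℝ) (f : ℝ≥0 → ℝ≥0) : Prop extends IsGood α f where
  one_lt : 1 < α
  exists_edge : ∃ (V : Type) (G : SimpleGraph V), (controlledClass α f).mem G ∧ G ≠ ⊥

/-! ### Ordered expansions and generic structures -/

/-- The data of a class of `L`-structures together with a relation `A ≤ B` between (the
substructure on) a subset `A` and a structure `B`. -/
structure StructureClass (L : FirstOrder.Language.{0, 0}) where
  /-- membership in the class -/
  mem : ∀ (B : Type) [L.Structure B], Prop
  /-- `le B A`: the substructure on `A` is closed in `B` -/
  le : ∀ (B : Type) [L.Structure B], Set B → Prop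

/-- The class `(K_{L*}, ⊑*)` of all ordered `L*`-expansions of graphs in `K`: here `L` is the
expanded language, `R` its edge symbol and `lt` its order symbol. -/
def GraphClass.orderedExpansion (K : GraphClass) {L : FirstOrder.Language.{0, 0}} (R lt : L.Relations 2) :
    StructureClass L where
  mem B _ := ∃ G : SimpleGraph B, (∀ a b : B, G.Adj a b ↔ Structure.RelMap R ![a, b]) ∧ K.mem G ∧
    IsStrictTotalOrder B (fun a b => Structure.RelMap lt ![a, b])
  le B _ A := ∃ G : SimpleGraph B, (∀ a b : B, G.Adj a b ↔ Structure.RelMap R ![a, b]) ∧ K.le G A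

/-- `A ≤ N` for a substructure `A` of a possibly infinite structure `N`: `A` is closed in every
finite substructure of `N` that contains it. -/
def StructureClass.IsClosedIn {L : FirstOrder.Language.{0, 0}} (𝒦 : StructureClass L) {N : Type}
    [L.Structure N] (A : L.Substructure N) : Prop :=
  ∀ B : L.Substructure N, Finite B → A ≤ B → 𝒦.le B {x | (x : N) ∈ A}

/-- `N` is the `(𝒦, ≤)`-generic structure. -/
structure StructureClass.IsGeneric {L : FirstOrder.Language.{0, 0}} (𝒦 : StructureClass L) (N : Type)
    [L.Structure N] : Prop where
  countable : Countable N
  /-- the finite substructures of `N` are, up to isomorphism, the members of `𝒦` -/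
  age : ∀ (B : Type) [L.Structure B], 𝒦.mem B ↔ Finite B ∧ Nonempty (B ↪[L] N)
  /-- `N` is the union of a chain of closed substructures in `𝒦` -/
  chain : ∃ A : ℕ → L.Substructure N, (∀ i, 𝒦.mem (A i)) ∧
    (∀ i, A i ≤ A (i + 1) ∧ 𝒦.le (A (i + 1)) {x | (x : N) ∈ A i}) ∧ ∀ x : N, ∃ i, x ∈ A i
  /-- if `A ≤ N` and `A ≤ B ∈ 𝒦`, then `B` has a closed embedding over `A` into `N` -/
  extension : ∀ A : L.Substructure N, Finite A → 𝒦.IsClosedIn A →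
    ∀ (B : Type) [L.Structure B], 𝒦.mem B → ∀ g : A ↪[L] B, 𝒦.le B (Set.range g) →
      ∃ h : B ↪[L] N, (∀ a : A, h (g a) = (a : N)) ∧ 𝒦.IsClosedIn h.toHom.range

/-! Extreme amenability is refuted by a single flow. Every finite subgraph on a vertex set `S` of
the generic graph has at most `α|S|` edges, so with `k = ⌈α⌉₊` Hall's theorem gives an orientation
of outdegree at most `k` (`orientations_nonempty`). These orientations form a compact space on which
the automorphism group acts continuously, and a fixed point is an invariant orientation
(`exists_invariant_orientation`).

Invariance contradicts homogeneity. Take a closed edge, oriented from `a` to `b` by the fixed point.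
By genericity `a` is also the centre of a closed star with `k + 1` leaves, all on the same side of
`a` in the order as `b`. Each edge of that star is closed and isomorphic to `(a, b)` as an ordered
structure, hence conjugate to it over `a` by a back-and-forth argument
(`IsGeneric.exists_equiv_extending`). So all `k + 1` leaves are out-neighbours of `a`, which is too
many (`not_isExtremelyAmenable_of_star_mem`).

It remains to see that the class contains all stars and that every set containing the centre is
closed in a star. A set of `s` vertices containing the centre has predimension `(α - 1)s + 1`, which
settles closedness. Membership is a computation for `K_α⁺`, follows by gluing edges at the centre
for the controlled classes (`GraphClass.IsSmooth.finStar_mem`), and is a count of copies for the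
collapsed classes with `α > 1` (`collapsedClass_finStar_mem`). For `α = 1` the collapsed class
bounds degrees and large stars are missing, but then no ordered generic structure exists at all
(`not_isGeneric_collapsedClass_one`). -/

/-! ### The predimension -/

section Predimension

variable {V W : Type} {α : ℝ}

/-- The edges of `G` with both endpoints in `S`. -/
def edgesIn (G : SimpleGraph V) (S : Set V) : Set (Sym2 V) :=
  {e | e ∈ G.edgeSet ∧ ∀ v ∈ e, v ∈ S}

theorem mk_mem_edgesIn {G : SimpleGraph V} {S : Set V} {a b : V} :
    s(a, b) ∈ edgesIn G S ↔ G.Adj a b ∧ a ∈ S ∧ b ∈ S := by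
  simp [edgesIn]

theorem edgesIn_image {G : SimpleGraph V} {H : SimpleGraph W} (f : G ↪g H) (A : Set V) :
    edgesIn H (f '' A) = Sym2.map f '' edgesIn G A := by
  ext e
  constructor
  · induction e with
    | _ x y =>
      rw [mk_mem_edgesIn]
      rintro ⟨h, ⟨a, ha, rfl⟩, ⟨b, hb, rfl⟩⟩
      exact ⟨s(a, b), mk_mem_edgesIn.2 ⟨f.map_adj_iff.1 h, ha, hb⟩, rfl⟩
  · rintro ⟨e, he, rfl⟩
    induction e with
    | _ x y =>
      rw [mk_mem_edgesIn] at he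
      exact mk_mem_edgesIn.2 ⟨f.map_adj_iff.2 he.1, ⟨x, he.2.1, rfl⟩, ⟨y, he.2.2, rfl⟩⟩

theorem ncard_edgesIn_image {G : SimpleGraph V} {H : SimpleGraph W} (f : G ↪g H) (A : Set V) :
    (edgesIn H (f '' A)).ncard = (edgesIn G A).ncard := by
  rw [edgesIn_image, Set.ncard_image_of_injective _ (Sym2.map.injective f.injective)]

/-- Counting edges inside the ambient `Sym2 V` puts the edge sets of different subsets into one
type, where they can be intersected, united and compared. -/
theorem predim_eq (G : SimpleGraph V) (A : Set V) :
    predim α G A = α * (A.ncard : ℝ) - ((edgesIn G A).ncard : ℝ) := by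
  have h := ncard_edgesIn_image (SimpleGraph.Embedding.induce (G := G) A) Set.univ
  have h1 : edgesIn (G.induce A) Set.univ = (G.induce A).edgeSet := by
    ext e; simp [edgesIn]
  have h2 : (SimpleGraph.Embedding.induce (G := G) A : A → V) '' Set.univ = A := by
    rw [Set.image_univ]; exact Subtype.range_coe
  rw [h1, h2] at h
  rw [predim, h]

theorem predim_image {G : SimpleGraph V} {H : SimpleGraph W} (f : G ↪g H) (A : Set V) :
    predim α H (f '' A) = predim α G A := by
  rw [predim_eq, predim_eq, ncard_edgesIn_image, Set.ncard_image_of_injective _ f.injective]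

theorem predim_induce (G : SimpleGraph V) (B : Set V) (C : Set B) :
    predim α (G.induce B) C = predim α G (Subtype.val '' C) :=
  (predim_image (SimpleGraph.Embedding.induce (G := G) B) C).symm

theorem predim_induce_setOf {G : SimpleGraph V} {A B : Set V} (h : A ⊆ B) :
    predim α (G.induce B) {x | (x : V) ∈ A} = predim α G A := by
  rw [predim_induce]
  congr 1
  ext x
  simpa using fun hx => h hx

theorem predim_empty (G : SimpleGraph V) : predim α G ∅ = 0 := by
  have : edgesIn G ∅ = ∅ := by
    ext e
    induction e with
    | _ x y => simp [mk_mem_edgesIn]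
  simp [predim_eq, this]

/-- Submodularity: vertices are counted equally on both sides, while edges between `A \ B` and `B \
A` are counted only in the union. -/
theorem predim_union_add_inter_le [Finite V] (G : SimpleGraph V) (A B : Set V) :
    predim α G (A ∪ B) + predim α G (A ∩ B) ≤ predim α G A + predim α G B := by
  have hc : (A ∪ B).ncard + (A ∩ B).ncard = A.ncard + B.ncard := Set.ncard_union_add_ncard_inter A B
  have he := Set.ncard_union_add_ncard_inter (edgesIn G A) (edgesIn G B)
  have hi : edgesIn G A ∩ edgesIn G B = edgesIn G (A ∩ B) := by
    ext e
    induction e with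
    | _ x y =>
      rw [Set.mem_inter_iff, mk_mem_edgesIn, mk_mem_edgesIn, mk_mem_edgesIn]
      simp only [Set.mem_inter_iff]
      tauto
  have hu : (edgesIn G A ∪ edgesIn G B).ncard ≤ (edgesIn G (A ∪ B)).ncard := by
    refine Set.ncard_le_ncard ?_ (Set.toFinite _)
    intro e
    induction e with
    | _ x y =>
      rw [Set.mem_union, mk_mem_edgesIn, mk_mem_edgesIn, mk_mem_edgesIn]
      simp only [Set.mem_union]
      tauto
  rw [hi] at he
  have hc' : ((A ∪ B).ncard : ℝ) + (A ∩ B).ncard = A.ncard + B.ncard := by exact_mod_cast hc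
  have he' : ((edgesIn G A).ncard : ℝ) + (edgesIn G B).ncard ≤
      (edgesIn G (A ∪ B)).ncard + (edgesIn G (A ∩ B)).ncard := by
    exact_mod_cast he ▸ Nat.add_le_add_right hu _
  simp only [predim_eq]
  linear_combination α * hc' + he'

theorem ncard_edgesIn_le {G : SimpleGraph V} {A : Set V} (h : 0 ≤ predim α G A) :
    ((edgesIn G A).ncard : ℝ) ≤ α * A.ncard := by
  rw [predim_eq] at h
  linarith

theorem MemPlus.of_embedding {G : SimpleGraph V} {H : SimpleGraph W} (f : G ↪g H)
    (h : MemPlus α H) : MemPlus α G :=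
  ⟨have := h.1; Finite.of_injective f f.injective, fun B => by
    rw [← predim_image f]; exact h.2 _⟩

end Predimension

/-! ### Closed subsets -/

section LeAlpha

variable {V W : Type} {α : ℝ} {G : SimpleGraph V}

theorem LeAlpha.univ (G : SimpleGraph V) : LeAlpha α G Set.univ := fun C hC => by
  rw [Set.univ_subset_iff.1 hC]

theorem LeAlpha.empty (h : MemPlus α G) : LeAlpha α G ∅ := fun C _ => by
  rw [predim_empty]; exact h.2 C

theorem LeAlpha.preimage {H : SimpleGraph W} (f : G ↪g H) {S : Set V}
    (h : LeAlpha α H (f '' S)) : LeAlpha α G S := by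
  intro C hC
  rw [← predim_image f, ← predim_image f]
  exact h _ (Set.image_mono hC)

/-- Transitivity of `≤_α`. For `C` above the image of `S`, closedness of `S` bounds the predimension
of `C ∩ range f` from below, and submodularity together with closedness of the range shows that `C`
has at least that predimension. -/
theorem LeAlpha.image {H : SimpleGraph W} [Finite W] (f : G ↪g H) {S : Set V}
    (h₁ : LeAlpha α G S) (h₂ : LeAlpha α H (Set.range f)) : LeAlpha α H (f '' S) := by
  intro C hC
  have h3 := h₁ (f ⁻¹' C) (Set.image_subset_iff.1 hC)
  rw [← predim_image f, ← predim_image f, Set.image_preimage_eq_inter_range] at h3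
  have h4 := h₂ (C ∪ Set.range f) Set.subset_union_right
  have h5 := predim_union_add_inter_le (α := α) H C (Set.range f)
  linarith

end LeAlpha

/-! ### Stars -/

section Star

variable {V : Type} {α : ℝ}

theorem predim_starGraph_of_notMem {r : V} {S : Set V} (h : r ∉ S) :
    predim α (SimpleGraph.starGraph r) S = α * S.ncard := by
  have : edgesIn (SimpleGraph.starGraph r) S = ∅ := by
    ext e
    induction e with
    | _ x y =>
      simp only [mk_mem_edgesIn, SimpleGraph.starGraph_adj, Set.mem_empty_iff_false, iff_false]
      rintro ⟨⟨-, rfl | rfl⟩, hx, hy⟩ <;> exact h ‹_›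
  simp [predim_eq, this]

/-- A subset containing the centre spans a tree, with one edge fewer than vertices. -/
theorem predim_starGraph_of_mem [Finite V] {r : V} {S : Set V} (h : r ∈ S) :
    predim α (SimpleGraph.starGraph r) S = (α - 1) * S.ncard + 1 := by
  have h1 : edgesIn (SimpleGraph.starGraph r) S = (fun x => s(r, x)) '' (S \ {r}) := by
    ext e
    induction e with
    | _ x y =>
      simp only [mk_mem_edgesIn, SimpleGraph.starGraph_adj, Set.mem_image, Set.mem_sdiff,
        Set.mem_singleton_iff]
      constructor
      · rintro ⟨⟨hne, rfl | rfl⟩, hx, hy⟩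
        · exact ⟨y, ⟨hy, Ne.symm hne⟩, rfl⟩
        · exact ⟨x, ⟨hx, hne⟩, Sym2.eq_swap⟩
      · rintro ⟨z, ⟨hz, hne⟩, he⟩
        rcases Sym2.eq_iff.1 he with ⟨rfl, rfl⟩ | ⟨rfl, rfl⟩
        · exact ⟨⟨Ne.symm hne, Or.inl rfl⟩, h, hz⟩
        · exact ⟨⟨hne, Or.inr rfl⟩, hz, h⟩
  have h2 : (edgesIn (SimpleGraph.starGraph r) S).ncard + 1 = S.ncard := by
    rw [h1, Set.ncard_image_of_injective, Set.ncard_sdiff_singleton_add_one h]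
    intro x y hxy
    exact Sym2.congr_right.1 hxy
  have h3 : ((edgesIn (SimpleGraph.starGraph r) S).ncard : ℝ) + 1 = S.ncard := by
    exact_mod_cast h2
  rw [predim_eq]
  linear_combination -h3

theorem memPlus_starGraph [Finite V] (hα : 1 ≤ α) (r : V) :
    MemPlus α (SimpleGraph.starGraph r) := by
  refine ⟨inferInstance, fun S => ?_⟩
  by_cases h : r ∈ S
  · rw [predim_starGraph_of_mem h]
    have : 0 ≤ (α - 1) * S.ncard := mul_nonneg (by linarith) (Nat.cast_nonneg _)
    linarith
  · rw [predim_starGraph_of_notMem h]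
    exact mul_nonneg (by linarith) (Nat.cast_nonneg _)

theorem leAlpha_starGraph [Finite V] (hα : 1 ≤ α) {r : V} {S : Set V} (h : r ∈ S) :
    LeAlpha α (SimpleGraph.starGraph r) S := by
  intro C hC
  rw [predim_starGraph_of_mem h, predim_starGraph_of_mem (hC h)]
  have : (S.ncard : ℝ) ≤ C.ncard := by exact_mod_cast Set.ncard_le_ncard hC
  have := mul_le_mul_of_nonneg_left this (sub_nonneg.2 hα)
  linarith

theorem ltAlpha_starGraph [Finite V] (hα : 1 < α) {r : V} {S : Set V} (h : r ∈ S) :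
    LtAlpha α (SimpleGraph.starGraph r) S := by
  intro C hC
  rw [predim_starGraph_of_mem h, predim_starGraph_of_mem (hC.1 h)]
  have : (S.ncard : ℝ) < C.ncard := by exact_mod_cast Set.ncard_lt_ncard hC
  have := mul_lt_mul_of_pos_left this (sub_pos.2 hα)
  linarith

end Star

/-! ### Closed substructures of generic structures -/

/-- The closure properties of a class of graphs that pass to generic structures. -/
structure GraphClass.HasClosures (K : GraphClass) : Prop where
  le_univ : ∀ {V : Type} {G : SimpleGraph V}, K.mem G → K.le G Set.univ
  empty_le : ∀ {V : Type} {G : SimpleGraph V}, K.mem G → K.le G ∅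
  le_image : ∀ {V W : Type} {G : SimpleGraph V} {H : SimpleGraph W} (f : G ↪g H) {S : Set V},
    K.mem G → K.mem H → K.le G S → K.le H (Set.range f) → K.le H (f '' S)
  le_preimage : ∀ {V W : Type} {G : SimpleGraph V} {H : SimpleGraph W} (f : G ↪g H) {S : Set V},
    K.mem G → K.mem H → K.le H (f '' S) → K.le G S

/-- Both nontrivial fields are transported along the isomorphism of `G` with the induced graph on
the range of `f`: images use transitivity, preimages use restriction to the range. -/
theorem GraphClass.IsSmooth.hasClosures {K : GraphClass} (hK : K.IsSmooth) : K.HasClosures where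
  le_univ := hK.le_refl
  empty_le := hK.empty_le
  le_image {V W G H} f S hG hH h₁ h₂ := by
    have h3 : f.isoInduceRange '' S = {x : Set.range f | (x : W) ∈ f '' S} := by
      ext x
      constructor
      · rintro ⟨y, hy, rfl⟩
        exact ⟨y, hy, rfl⟩
      · rintro ⟨y, hy, hyx⟩
        exact ⟨y, hy, Subtype.ext hyx⟩
    exact hK.le_trans hH (Set.image_subset_range f S)
      (h3 ▸ hK.le_iso f.isoInduceRange S hG h₁) h₂
  le_preimage {V W G H} f S hG hH h := by
    have h3 : f.isoInduceRange.symm '' {x | (x : W) ∈ f '' S} = S := by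
      ext x
      constructor
      · rintro ⟨_, ⟨y, hy, hyz⟩, rfl⟩
        rw [← f.isoInduceRange.symm_apply_apply y] at hy
        convert hy using 2
        exact Subtype.ext hyz.symm
      · intro hx
        exact ⟨f.isoInduceRange x, ⟨x, hx, rfl⟩, f.isoInduceRange.symm_apply_apply x⟩
    rw [← h3]
    exact hK.le_iso _ _ (hK.mem_induce _ hH)
      (hK.le_of_subset hH (Set.image_subset_range f S) h)

/-- The closure properties of a class of structures that pass to its generic structure. -/
structure StructureClass.HasClosures {L : FirstOrder.Language.{0, 0}} (𝒦 : StructureClass L) :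
    Prop where
  le_univ : ∀ {B : Type} [L.Structure B], 𝒦.mem B → 𝒦.le B Set.univ
  empty_le : ∀ {B : Type} [L.Structure B], 𝒦.mem B → 𝒦.le B ∅
  le_image : ∀ {B C : Type} [L.Structure B] [L.Structure C] (f : B ↪[L] C) {S : Set B},
    𝒦.mem B → 𝒦.mem C → 𝒦.le B S → 𝒦.le C (Set.range f) → 𝒦.le C (f '' S)
  le_preimage : ∀ {B C : Type} [L.Structure B] [L.Structure C] (f : B ↪[L] C) {S : Set B},
    𝒦.mem B → 𝒦.mem C → 𝒦.le C (f '' S) → 𝒦.le B S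

section OrderedExpansion

variable {L : FirstOrder.Language.{0, 0}} {R lt : L.Relations 2} {K : GraphClass}

/-- An embedding of structures induces an embedding of the graphs given by a binary relation. -/
def graphEmbedding {B C : Type} [L.Structure B] [L.Structure C] {G : SimpleGraph B}
    {H : SimpleGraph C} (hG : ∀ a b : B, G.Adj a b ↔ Structure.RelMap R ![a, b])
    (hH : ∀ a b : C, H.Adj a b ↔ Structure.RelMap R ![a, b]) (f : B ↪[L] C) : G ↪g H where
  toEmbedding := f.toEmbedding
  map_rel_iff' {a b} := by
    have h := f.map_rel R ![a, b]
    have h' : f ∘ ![a, b] = ![f a, f b] := by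
      funext i; fin_cases i <;> rfl
    rw [h'] at h
    exact (hH _ _).trans (h.trans (hG _ _).symm)

theorem simpleGraph_eq_of_adj_iff {B : Type} [L.Structure B] {G H : SimpleGraph B}
    (hG : ∀ a b : B, G.Adj a b ↔ Structure.RelMap R ![a, b])
    (hH : ∀ a b : B, H.Adj a b ↔ Structure.RelMap R ![a, b]) : G = H := by
  ext a b
  rw [hG, hH]

theorem GraphClass.HasClosures.orderedExpansion (hK : K.HasClosures) :
    (K.orderedExpansion R lt).HasClosures where
  le_univ := fun ⟨G, hG, h, _⟩ => ⟨G, hG, hK.le_univ h⟩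
  empty_le := fun ⟨G, hG, h, _⟩ => ⟨G, hG, hK.empty_le h⟩
  le_image := by
    rintro B C _ _ f S ⟨G, hG, hGm, -⟩ ⟨H, hH, hHm, -⟩ ⟨G', hG', h₁⟩ ⟨H', hH', h₂⟩
    obtain rfl := simpleGraph_eq_of_adj_iff hG hG'
    obtain rfl := simpleGraph_eq_of_adj_iff hH hH'
    exact ⟨H, hH, hK.le_image (graphEmbedding hG hH f) hGm hHm h₁ h₂⟩
  le_preimage := by
    rintro B C _ _ f S ⟨G, hG, hGm, -⟩ ⟨H, hH, hHm, -⟩ ⟨H', hH', h⟩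
    obtain rfl := simpleGraph_eq_of_adj_iff hH hH'
    exact ⟨G, hG, hK.le_preimage (graphEmbedding hG hH f) hGm hHm h⟩

end OrderedExpansion

/-! ### Homogeneity of generic structures over finite closed substructures. -/

namespace StructureClass

variable {L : FirstOrder.Language.{0, 0}} {𝒦 : StructureClass L} {N : Type} [L.Structure N]

theorem IsGeneric.mem_of_finite (hN : 𝒦.IsGeneric N) (B : L.Substructure N) [Finite B] :
    𝒦.mem B :=
  (hN.age B).2 ⟨inferInstance, ⟨B.subtype⟩⟩

theorem IsGeneric.finite (hN : 𝒦.IsGeneric N) {B : Type} [L.Structure B] (hB : 𝒦.mem B) :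
    Finite B :=
  ((hN.age B).1 hB).1

theorem HasClosures.le_trans_substructure (h𝒦 : 𝒦.HasClosures) (hN : 𝒦.IsGeneric N)
    {A B C : L.Substructure N} [Finite B] [Finite C] (hBC : B ≤ C)
    (h₁ : 𝒦.le B {x | (x : N) ∈ A}) (h₂ : 𝒦.le C {x | (x : N) ∈ B}) (hAB : A ≤ B) :
    𝒦.le C {x | (x : N) ∈ A} := by
  have h3 : Set.range (Substructure.inclusion hBC) = {x : C | (x : N) ∈ B} := by
    ext x
    exact ⟨by rintro ⟨y, rfl⟩; exact y.2, fun hx => ⟨⟨x, hx⟩, rfl⟩⟩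
  have h4 : Substructure.inclusion hBC '' {x | (x : N) ∈ A} = {x : C | (x : N) ∈ A} := by
    ext x
    exact ⟨by rintro ⟨y, hy, rfl⟩; exact hy, fun hx => ⟨⟨x, hAB hx⟩, hx, rfl⟩⟩
  have h5 := h𝒦.le_image (Substructure.inclusion hBC) (hN.mem_of_finite B) (hN.mem_of_finite C)
    h₁ (h3 ▸ h₂)
  rwa [h4] at h5

theorem HasClosures.le_of_le_substructure (h𝒦 : 𝒦.HasClosures) (hN : 𝒦.IsGeneric N)
    {A B C : L.Substructure N} [Finite B] [Finite C] (hAB : A ≤ B) (hBC : B ≤ C)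
    (h : 𝒦.le C {x | (x : N) ∈ A}) : 𝒦.le B {x | (x : N) ∈ A} := by
  have h4 : Substructure.inclusion hBC '' {x | (x : N) ∈ A} = {x : C | (x : N) ∈ A} := by
    ext x
    exact ⟨by rintro ⟨y, hy, rfl⟩; exact hy, fun hx => ⟨⟨x, hAB hx⟩, hx, rfl⟩⟩
  exact h𝒦.le_preimage (Substructure.inclusion hBC) (hN.mem_of_finite B) (hN.mem_of_finite C)
    (h4.symm ▸ h)

/-- A member of the chain containing `S` works: any finite `B` above it lies in a later member, in
which the earlier one is closed by transitivity, and closedness restricts to `B`. -/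
theorem IsGeneric.exists_isClosedIn (hN : 𝒦.IsGeneric N) (h𝒦 : 𝒦.HasClosures) {S : Set N}
    (hS : S.Finite) : ∃ B : L.Substructure N, Finite B ∧ 𝒦.IsClosedIn B ∧ S ⊆ B := by
  obtain ⟨A, hmem, hle, hex⟩ := hN.chain
  have hfin : ∀ i, Finite (A i) := fun i => hN.finite (hmem i)
  have hmono : Monotone A := monotone_nat_of_le_succ fun i => (hle i).1
  have hsub : ∀ T : Set N, T.Finite → ∀ i, ∃ j, i ≤ j ∧ T ⊆ A j := by
    intro T hT i
    induction T, hT using Set.Finite.induction_on with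
    | empty => exact ⟨i, le_rfl, Set.empty_subset _⟩
    | @insert a T _ _ ih =>
      obtain ⟨j, hij, hj⟩ := ih
      obtain ⟨k, hk⟩ := hex a
      exact ⟨max j k, hij.trans (le_max_left _ _), Set.insert_subset
        (hmono (le_max_right _ _) hk) (hj.trans (hmono (le_max_left _ _)))⟩
  have hle' : ∀ i j, i ≤ j → 𝒦.le (A j) {x | (x : N) ∈ A i} := by
    intro i j hij
    induction j, hij using Nat.le_induction with
    | base =>
      have : {x : A i | (x : N) ∈ A i} = Set.univ := Set.eq_univ_of_forall fun x => x.2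
      rw [this]
      exact h𝒦.le_univ (hmem i)
    | succ j hij ih => exact h𝒦.le_trans_substructure hN (hle j).1 ih (hle j).2 (hmono hij)
  obtain ⟨i, -, hi⟩ := hsub S hS 0
  refine ⟨A i, hfin i, fun B hB hAB => ?_, hi⟩
  obtain ⟨j, hij, hj⟩ := hsub (B : Set N) (Set.toFinite _) i
  exact h𝒦.le_of_le_substructure hN hAB (SetLike.coe_subset_coe.1 hj) (hle' i j hij)

theorem IsClosedIn.trans [L.IsRelational] (hN : 𝒦.IsGeneric N) (h𝒦 : 𝒦.HasClosures)
    {A B : L.Substructure N} [Finite B] (hAB : A ≤ B) (h : 𝒦.le B {x | (x : N) ∈ A})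
    (hB : 𝒦.IsClosedIn B) : 𝒦.IsClosedIn A := by
  intro C _ hAC
  -- `C` need not contain `B`, so closedness is proved in `B ∪ C`, a substructure because the
  -- language is relational, and then restricted to `C`.
  have hD : ((Substructure.closure L ((B : Set N) ∪ (C : Set N)) : L.Substructure N) : Set N) = (B : Set N) ∪ C :=
    Substructure.closure_eq_of_isRelational L _
  generalize Substructure.closure L ((B : Set N) ∪ (C : Set N)) = D at hD
  have hBD : B ≤ D := SetLike.coe_subset_coe.1 (hD ▸ Set.subset_union_left)
  have hCD : C ≤ D := SetLike.coe_subset_coe.1 (hD ▸ Set.subset_union_right)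
  have : Finite D := by
    have : ((B : Set N) ∪ (C : Set N)).Finite := (Set.toFinite _).union (Set.toFinite _)
    rw [← hD] at this
    exact this.to_subtype
  exact h𝒦.le_of_le_substructure hN hAC hCD
    (h𝒦.le_trans_substructure hN hBD h (hB D inferInstance hBD) hAB)

/-- The image of a closed subset under a closed embedding is closed. -/
theorem IsClosedIn.image [L.IsRelational] (hN : 𝒦.IsGeneric N) (h𝒦 : 𝒦.HasClosures)
    {B : Type} [L.Structure B] (hB : 𝒦.mem B) {h : B ↪[L] N} (hh : 𝒦.IsClosedIn h.toHom.range)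
    {A : L.Substructure N} {S : Set B} (hS : 𝒦.le B S) (hA : (A : Set N) = h '' S) :
    𝒦.IsClosedIn A := by
  have hfB : Finite B := hN.finite hB
  have hfr : Finite h.toHom.range := Finite.of_equiv B h.equivRange.toEquiv
  have hAr : A ≤ h.toHom.range := by
    rw [← SetLike.coe_subset_coe, hA]
    rintro _ ⟨x, -, rfl⟩
    exact ⟨x, rfl⟩
  refine IsClosedIn.trans hN h𝒦 hAr ?_ hh
  have h1 : Set.range (h.equivRange.toEmbedding) = Set.univ :=
    Set.range_eq_univ.2 h.equivRange.surjective
  have h2 := h𝒦.le_image h.equivRange.toEmbedding hB (hN.mem_of_finite _) hS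
    (h1 ▸ h𝒦.le_univ (hN.mem_of_finite _))
  convert h2 using 1
  ext x
  change (x : N) ∈ (A : Set N) ↔ _
  rw [hA]
  constructor
  · rintro ⟨y, hy, hyx⟩
    exact ⟨y, hy, Subtype.ext hyx⟩
  · rintro ⟨y, hy, rfl⟩
    exact ⟨y, hy, rfl⟩

theorem IsGeneric.isClosedIn_bot [L.IsRelational] (hN : 𝒦.IsGeneric N) (h𝒦 : 𝒦.HasClosures) :
    𝒦.IsClosedIn (⊥ : L.Substructure N) := by
  intro B _ _
  have : {x : B | (x : N) ∈ (⊥ : L.Substructure N)} = ∅ := by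
    ext x
    have h : ((⊥ : L.Substructure N) : Set N) = ∅ := by
      rw [← Substructure.closure_empty]
      exact Substructure.closure_eq_of_isRelational L _
    exact ⟨fun hx => (h.subset hx).elim, fun hx => hx.elim⟩
  rw [this]
  exact h𝒦.empty_le (hN.mem_of_finite B)

/-- Partial isomorphisms between finite closed substructures. -/
abbrev ClosedEquiv (𝒦 : StructureClass L) (N : Type) [L.Structure N] :=
  {p : N ≃ₚ[L] N // Finite p.dom ∧ 𝒦.IsClosedIn p.dom ∧ 𝒦.IsClosedIn p.cod}

/-- The inverse of a partial isomorphism between finite closed substructures. -/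
def ClosedEquiv.symm (p : ClosedEquiv 𝒦 N) : ClosedEquiv 𝒦 N :=
  ⟨p.1.symm, have := p.2.1; Finite.of_equiv _ p.1.toEquiv.toEquiv, p.2.2.2, p.2.2.1⟩

/-- The forth step: the domain together with `x` is enlarged to a finite closed `B`, and the
extension property embeds `B` over the old codomain. The back step is the same applied to the
inverse. -/
theorem IsGeneric.exists_le_mem_dom (hN : 𝒦.IsGeneric N) (h𝒦 : 𝒦.HasClosures)
    (p : ClosedEquiv 𝒦 N) (x : N) : ∃ q : ClosedEquiv 𝒦 N, x ∈ q.1.dom ∧ p ≤ q := by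
  obtain ⟨⟨A, A', e⟩, hfin, hA, hA'⟩ := p
  dsimp only at hfin hA hA'
  obtain ⟨B, hB, hBc, hsub⟩ := hN.exists_isClosedIn h𝒦
    (show (insert x (A : Set N)).Finite from (Set.toFinite _).insert x)
  have hAB : A ≤ B := fun a ha => hsub (Or.inr ha)
  have hfin' : Finite A' := Finite.of_equiv _ e.toEquiv
  let g : A' ↪[L] B := (Substructure.inclusion hAB).comp e.symm.toEmbedding
  have hg : Set.range g = {y : B | (y : N) ∈ A} := by
    ext y
    constructor
    · rintro ⟨z, rfl⟩
      exact (e.symm z).2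
    · intro hy
      refine ⟨e ⟨y, hy⟩, Subtype.ext ?_⟩
      change ((e.symm (e ⟨y, hy⟩) : A) : N) = y
      rw [e.symm_apply_apply]
  obtain ⟨h, hh, hhc⟩ := hN.extension A' hfin' hA' B (hN.mem_of_finite B) g
    (hg ▸ hA B hB hAB)
  refine ⟨⟨⟨B, h.toHom.range, h.equivRange⟩, hB, hBc, hhc⟩, hsub (Or.inl rfl), ⟨hAB, ?_⟩⟩
  ext a
  have h1 := hh (e a)
  have h2 : g (e a) = Substructure.inclusion hAB a := by
    change Substructure.inclusion hAB (e.symm (e a)) = _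
    rw [e.symm_apply_apply]
  rw [h2] at h1
  exact h1

/-- Generic structures are homogeneous with respect to finite closed substructures. -/
theorem IsGeneric.exists_equiv_extending (hN : 𝒦.IsGeneric N) (h𝒦 : 𝒦.HasClosures)
    (p : ClosedEquiv 𝒦 N) : ∃ g : N ≃[L] N, ∀ a : p.1.dom, g a = p.1.toEquiv a := by
  have := hN.countable
  have : Encodable N := Encodable.ofCountable N
  -- One cofinal requirement for each element: left summands must enter the domain, right summands
  -- the codomain. A chain meeting all of them has a total and surjective limit.
  let D : N ⊕ N → Order.Cofinal (ClosedEquiv 𝒦 N) := fun s => Sum.recOn s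
    (fun x => ⟨{q | x ∈ q.1.dom}, fun p => hN.exists_le_mem_dom h𝒦 p x⟩)
    (fun x => ⟨{q | x ∈ q.1.cod}, fun p => by
      obtain ⟨q, hq, hpq⟩ := hN.exists_le_mem_dom h𝒦 p.symm x
      exact ⟨q.symm, hq, PartialEquiv.monotone_symm hpq⟩⟩)
  let S : ℕ →o N ≃ₚ[L] N :=
    ⟨Subtype.val ∘ Order.sequenceOfCofinals p D,
      (Subtype.mono_coe _).comp (Order.sequenceOfCofinals.monotone _ _)⟩
  let F := DirectLimit.partialEquivLimit S
  have hdom : F.dom = ⊤ := top_le_iff.1 fun x _ =>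
    PartialEquiv.dom_le_dom (DirectLimit.le_partialEquivLimit S (Encodable.encode
      (Sum.inl x : N ⊕ N) + 1)) (Order.sequenceOfCofinals.encode_mem p D (Sum.inl x))
  have hcod : F.cod = ⊤ := top_le_iff.1 fun x _ =>
    PartialEquiv.cod_le_cod (DirectLimit.le_partialEquivLimit S (Encodable.encode
      (Sum.inr x : N ⊕ N) + 1)) (Order.sequenceOfCofinals.encode_mem p D (Sum.inr x))
  have hp : p.1 ≤ F := DirectLimit.le_partialEquivLimit S 0
  refine ⟨PartialEquiv.toEquivOfEqTop hdom hcod, fun a => ?_⟩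
  have h1 : PartialEquiv.toEquivOfEqTop hdom hcod (a : N) =
      PartialEquiv.toEmbeddingOfEqTop hdom (a : N) := by
    rw [← PartialEquiv.toEquivOfEqTop_toEmbedding hdom hcod]
    rfl
  rw [h1, PartialEquiv.toEmbeddingOfEqTop_apply]
  exact congrArg Subtype.val (PartialEquiv.toEquiv_inclusion_apply hp a)

/-- Two closed embeddings of the same member of the class are conjugate. -/
theorem IsGeneric.exists_equiv_comp_eq (hN : 𝒦.IsGeneric N) (h𝒦 : 𝒦.HasClosures)
    {B : Type} [L.Structure B] [Finite B] (h h' : B ↪[L] N) (hh : 𝒦.IsClosedIn h.toHom.range)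
    (hh' : 𝒦.IsClosedIn h'.toHom.range) : ∃ g : N ≃[L] N, ∀ b, g (h b) = h' b := by
  obtain ⟨g, hg⟩ := hN.exists_equiv_extending h𝒦
    ⟨⟨h.toHom.range, h'.toHom.range, h'.equivRange.comp h.equivRange.symm⟩,
      Finite.of_equiv B h.equivRange.toEquiv, hh, hh'⟩
  refine ⟨g, fun b => (hg ⟨h b, b, rfl⟩).trans ?_⟩
  change ((h'.equivRange (h.equivRange.symm (h.equivRange b)) : h'.toHom.range) : N) = h' b
  rw [h.equivRange.symm_apply_apply]
  rfl

end StructureClass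

/-! ### The flow of orientations of bounded outdegree -/

section Orientations

variable {N : Type}

/-- The orientations of a graph (edges may be oriented both ways) with outdegrees at most `k`. -/
def orientations (G : SimpleGraph N) (k : ℕ) : Set (N × N → Bool) :=
  {o | (∀ a b, G.Adj a b → o (a, b) = true ∨ o (b, a) = true) ∧
    ∀ (a : N) (s : Finset N), (∀ b ∈ s, o (a, b) = true) → s.card ≤ k}

/-- Testing outdegrees on finite sets `s` makes every condition depend on finitely many coordinates,
so each one is clopen. -/
theorem isClosed_orientations (G : SimpleGraph N) (k : ℕ) : IsClosed (orientations G k) := by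
  have hc : ∀ p : N × N, Continuous fun o : N × N → Bool => o p := fun p => continuous_apply p
  have hop : ∀ p : N × N, IsOpen {o : N × N → Bool | o p = true} := fun p =>
    (isOpen_discrete ({true} : Set Bool)).preimage (hc p)
  have hcl : ∀ p : N × N, IsClosed {o : N × N → Bool | o p = true} := fun p =>
    (isClosed_discrete ({true} : Set Bool)).preimage (hc p)
  have h : orientations G k =
      (⋂ (a) (b) (_ : G.Adj a b), {o | o (a, b) = true} ∪ {o | o (b, a) = true}) ∩
        ⋂ (a) (s : Finset N) (_ : k < s.card), (⋂ b ∈ s, {o | o (a, b) = true})ᶜ := by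
    ext o
    simp only [orientations, Set.mem_inter_iff, Set.mem_iInter, Set.mem_union, Set.mem_compl_iff,
      Set.mem_ofPred_eq]
    exact and_congr Iff.rfl (forall₂_congr fun a s => by rw [← not_lt]; tauto)
  rw [h]
  refine IsClosed.inter ?_ ?_
  · exact isClosed_iInter fun a => isClosed_iInter fun b => isClosed_iInter fun _ =>
      (hcl _).union (hcl _)
  · exact isClosed_iInter fun a => isClosed_iInter fun s => isClosed_iInter fun _ =>
      (s.finite_toSet.isOpen_biInter fun b _ => hop (a, b)).isClosed_compl

/-- A graph all of whose finite subgraphs are sparse has an orientation of bounded outdegree. -/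
theorem orientations_nonempty {G : SimpleGraph N} {k : ℕ}
    (hG : ∀ S : Set N, S.Finite → (edgesIn G S).ncard ≤ k * S.ncard) :
    (orientations G k).Nonempty := by
  classical
  -- Each vertex offers `k` slots and an edge may occupy any slot of either endpoint. Hall's
  -- condition is the sparsity bound on the set `S` of endpoints; an edge is then directed out of
  -- the vertex whose slot it occupies.
  let t : G.edgeSet → Finset (N × Fin k) := fun e => (e : Sym2 N).toFinset ×ˢ Finset.univ
  obtain ⟨f, hf, hft⟩ := (Finset.all_card_le_biUnion_card_iff_exists_injective t).1 (by
    intro s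
    let S : Finset N := s.biUnion fun e => (e : Sym2 N).toFinset
    have h1 : s.biUnion t = S ×ˢ Finset.univ := by
      ext p
      simp [S, t]
    have h2 : ((s.image Subtype.val : Finset (Sym2 N)) : Set (Sym2 N)) ⊆ edgesIn G S := by
      intro e he
      obtain ⟨e', he', rfl⟩ := Finset.mem_image.1 (Finset.mem_coe.1 he)
      exact ⟨e'.2, fun v hv => Finset.mem_coe.2 (Finset.mem_biUnion.2
        ⟨e', he', Sym2.mem_toFinset.2 hv⟩)⟩
    have h3 : (edgesIn G (S : Set N)).Finite := by
      refine S.sym2.finite_toSet.subset fun e he => ?_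
      exact Finset.mem_coe.2 (Finset.mem_sym2_iff.2 fun v hv => Finset.mem_coe.1 (he.2 v hv))
    have h4 := Set.ncard_le_ncard h2 h3
    rw [Set.ncard_coe_finset, Finset.card_image_of_injective _ Subtype.val_injective] at h4
    have h5 := hG S S.finite_toSet
    rw [Set.ncard_coe_finset] at h5
    rw [h1, Finset.card_product, Finset.card_univ, Fintype.card_fin, mul_comm]
    exact h4.trans h5)
  have hmem : ∀ e : G.edgeSet, (f e).1 ∈ (e : Sym2 N) := fun e =>
    Sym2.mem_toFinset.1 (Finset.mem_product.1 (hft e)).1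
  refine ⟨fun p => decide (∃ h : G.Adj p.1 p.2, (f ⟨s(p.1, p.2), h⟩).1 = p.1), ?_, ?_⟩
  · intro a b hab
    simp only [decide_eq_true_eq]
    rcases Sym2.mem_iff.1 (hmem ⟨s(a, b), hab⟩) with h | h
    · exact Or.inl ⟨hab, h⟩
    · have h1 : (⟨s(a, b), hab⟩ : G.edgeSet) = ⟨s(b, a), hab.symm⟩ := Subtype.ext Sym2.eq_swap
      exact Or.inr ⟨hab.symm, h1 ▸ h⟩
  · intro a s hs
    simp only [decide_eq_true_eq] at hs
    choose hadj hfa using hs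
    -- Edges leaving `a` occupy distinct slots of `a`, and there are only `k`.
    have := Fintype.card_le_of_injective
      (fun b : s => (f ⟨s(a, (b : N)), hadj b b.2⟩).2) (by
        intro b c hbc
        have h1 := hf (Prod.ext ((hfa b b.2).trans (hfa c c.2).symm) hbc)
        exact Subtype.ext (Sym2.congr_right.1 (congrArg Subtype.val h1)))
    simpa using this

end Orientations

section Flow

variable {L : FirstOrder.Language.{0, 0}} {N : Type} [L.Structure N]

theorem exists_invariant_orientation (hext : IsExtremelyAmenable (autGroup L N))
    {G : SimpleGraph N} {k : ℕ} (hinv : ∀ (g : N ≃[L] N) (a b : N), G.Adj (g a) (g b) ↔ G.Adj a b)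
    (hG : ∀ S : Set N, S.Finite → (edgesIn G S).ncard ≤ k * S.ncard) :
    ∃ o ∈ orientations G k, ∀ (g : N ≃[L] N) (a b : N), o (g a, g b) = o (a, b) := by
  have hcompact : CompactSpace (orientations G k) :=
    isCompact_iff_compactSpace.1 (isClosed_orientations G k).isCompact
  have hne : Nonempty (orientations G k) := (orientations_nonempty hG).to_subtype
  have hinv' : ∀ (g : autGroup L N) (a b : N),
      G.Adj ((g : Equiv.Perm N) a) ((g : Equiv.Perm N) b) ↔ G.Adj a b := by
    rintro ⟨_, e, rfl⟩ a b
    exact hinv e a b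
  let _ : MulAction (autGroup L N) (orientations G k) :=
    { smul := fun g o => ⟨fun p => o.1 (((g⁻¹ : autGroup L N) : Equiv.Perm N) p.1,
          ((g⁻¹ : autGroup L N) : Equiv.Perm N) p.2),
        fun a b hab => o.2.1 _ _ ((hinv' _ _ _).2 hab), fun a s hs => by
          classical
          rw [← Finset.card_map ((g⁻¹ : autGroup L N) : Equiv.Perm N).toEmbedding]
          refine o.2.2 (((g⁻¹ : autGroup L N) : Equiv.Perm N) a) _ fun b hb => ?_
          obtain ⟨c, hc, rfl⟩ := Finset.mem_map.1 hb
          exact hs c hc⟩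
      one_smul := fun o => by
        refine Subtype.ext (funext fun p => ?_)
        change o.1 (((1⁻¹ : autGroup L N) : Equiv.Perm N) p.1,
          ((1⁻¹ : autGroup L N) : Equiv.Perm N) p.2) = o.1 p
        rw [inv_one]
        rfl
      mul_smul := fun g h o => by
        refine Subtype.ext (funext fun p => ?_)
        change o.1 ((((g * h)⁻¹ : autGroup L N) : Equiv.Perm N) p.1,
          (((g * h)⁻¹ : autGroup L N) : Equiv.Perm N) p.2) = _
        rw [mul_inv_rev]
        rfl }
  have hsmul : ∀ (g : autGroup L N) (o : orientations G k) (a b : N), (g • o).1 (a, b) =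
      o.1 (((g⁻¹ : autGroup L N) : Equiv.Perm N) a, ((g⁻¹ : autGroup L N) : Equiv.Perm N) b) :=
    fun _ _ _ _ => rfl
  have hev : ∀ x y : N, IsOpen {g : autGroup L N | (g : Equiv.Perm N) x = y} := by
    intro x y
    let _ : TopologicalSpace N := ⊥
    have _ : DiscreteTopology N := ⟨rfl⟩
    have hind : Topology.IsInducing (fun g : autGroup L N => ((g : Equiv.Perm N) : N → N)) := ⟨rfl⟩
    exact (isOpen_discrete {y}).preimage ((continuous_apply x).comp hind.continuous)
  have _ : ContinuousSMul (autGroup L N) (orientations G k) := by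
    refine ⟨continuous_induced_rng.2 (continuous_pi fun p => ?_)⟩
    refine continuous_discrete_rng.2 fun z => isOpen_iff_forall_mem_open.2 ?_
    rintro ⟨g, o⟩ hgo
    obtain ⟨a, b⟩ := p
    set a' := ((g⁻¹ : autGroup L N) : Equiv.Perm N) a with ha'
    set b' := ((g⁻¹ : autGroup L N) : Equiv.Perm N) b with hb'
    -- The value of `g • o` at `(a, b)` is determined by `g⁻¹ a`, `g⁻¹ b` and a single coordinate of
    -- `o`, each locally constant.
    refine ⟨{q | (((q.1⁻¹ : autGroup L N) : Equiv.Perm N) a = a' ∧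
      ((q.1⁻¹ : autGroup L N) : Equiv.Perm N) b = b') ∧ q.2.1 (a', b') = z}, ?_, ?_, ?_⟩
    · rintro ⟨h, o'⟩ ⟨⟨h1, h2⟩, h3⟩
      change (h • o').1 (a, b) = z
      rw [hsmul, h1, h2, h3]
    · refine IsOpen.inter (IsOpen.inter ?_ ?_) ?_
      · exact (hev a a').preimage (continuous_inv.comp continuous_fst)
      · exact (hev b b').preimage (continuous_inv.comp continuous_fst)
      · have hc : Continuous fun o : N × N → Bool => o (a', b') := continuous_apply _
        exact (isOpen_discrete ({z} : Set Bool)).preimage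
          (hc.comp (continuous_subtype_val.comp continuous_snd))
    · exact ⟨⟨rfl, rfl⟩, hgo⟩
  obtain ⟨o, ho⟩ := hext (orientations G k)
  refine ⟨o.1, o.2, fun g a b => ?_⟩
  have h1 := hsmul ⟨g.toEquiv, g, rfl⟩⁻¹ o a b
  rw [ho, inv_inv] at h1
  exact h1.symm

end Flow

/-! ### Ordered graphs as structures -/

section OrderedGraph

variable {L : FirstOrder.Language.{0, 0}} {B C : Type}

/-- The structure on the vertices of `G` in which `R` is adjacency, `lt` is the relation `r` and
all other relations are empty. -/
def OrderedGraph (_R _lt : L.Relations 2) {B : Type} (_G : SimpleGraph B) (_r : B → B → Prop) :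
    Type :=
  B

variable {R lt : L.Relations 2} {G : SimpleGraph B} {H : SimpleGraph C} {r : B → B → Prop}
  {s : C → C → Prop}

instance [Finite B] : Finite (OrderedGraph R lt G r) := inferInstanceAs (Finite B)

/-- Arity, symbol and tuple are compared together in a sigma type, so symbols of every arity are
treated at once and no cast of tuples is needed. -/
instance [L.IsRelational] : L.Structure (OrderedGraph R lt G r) where
  funMap f := isEmptyElim f
  RelMap {n} Q v := ∃ a b : B,
    ((⟨n, Q, v⟩ : Σ n, L.Relations n × (Fin n → B)) = ⟨2, R, ![a, b]⟩ ∧ G.Adj a b) ∨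
    ((⟨n, Q, v⟩ : Σ n, L.Relations n × (Fin n → B)) = ⟨2, lt, ![a, b]⟩ ∧ r a b)

variable [L.IsRelational]

theorem relMap_orderedGraph {n : ℕ} {Q : L.Relations n} {v : Fin n → OrderedGraph R lt G r} :
    Structure.RelMap Q v ↔ ∃ a b : B,
      ((⟨n, Q, v⟩ : Σ n, L.Relations n × (Fin n → B)) = ⟨2, R, ![a, b]⟩ ∧ G.Adj a b) ∨
      ((⟨n, Q, v⟩ : Σ n, L.Relations n × (Fin n → B)) = ⟨2, lt, ![a, b]⟩ ∧ r a b) :=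
  Iff.rfl

theorem relMap_edge (hR : R ≠ lt) (a b : B) :
    Structure.RelMap (M := OrderedGraph R lt G r) R ![a, b] ↔ G.Adj a b := by
  rw [relMap_orderedGraph]
  constructor
  · rintro ⟨c, d, ⟨h, hcd⟩ | ⟨h, -⟩⟩
    · have h' := congrFun (Prod.ext_iff.1 (eq_of_heq (Sigma.mk.inj h).2)).2
      have h0 : a = c := h' 0
      have h1 : b = d := h' 1
      rwa [h0, h1]
    · exact absurd (Prod.ext_iff.1 (eq_of_heq (Sigma.mk.inj h).2)).1 hR
  · intro h
    exact ⟨a, b, Or.inl ⟨rfl, h⟩⟩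

theorem relMap_lt (hR : R ≠ lt) (a b : B) :
    Structure.RelMap (M := OrderedGraph R lt G r) lt ![a, b] ↔ r a b := by
  rw [relMap_orderedGraph]
  constructor
  · rintro ⟨c, d, ⟨h, -⟩ | ⟨h, hcd⟩⟩
    · exact absurd (Prod.ext_iff.1 (eq_of_heq (Sigma.mk.inj h).2)).1 hR.symm
    · have h' := congrFun (Prod.ext_iff.1 (eq_of_heq (Sigma.mk.inj h).2)).2
      have h0 : a = c := h' 0
      have h1 : b = d := h' 1
      rwa [h0, h1]
  · intro h
    exact ⟨a, b, Or.inr ⟨rfl, h⟩⟩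

/-- An order-preserving embedding of graphs is an embedding of the associated structures. -/
def OrderedGraph.embedding (f : G ↪g H) (hf : ∀ a b, s (f a) (f b) ↔ r a b) :
    OrderedGraph R lt G r ↪[L] OrderedGraph R lt H s where
  toEmbedding := f.toEmbedding
  map_fun' g := isEmptyElim g
  map_rel' {n} Q v := by
    change Structure.RelMap (M := OrderedGraph R lt H s) Q (f ∘ v) ↔ _
    rw [relMap_orderedGraph, relMap_orderedGraph]
    -- A related tuple in the image of `f` comes from a tuple of vertices of `G`; `key'` is the
    -- converse direction.
    have key : ∀ (Q' : L.Relations 2) (c d : C),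
        (⟨n, Q, (f ∘ v : Fin n → C)⟩ : Σ n, L.Relations n × (Fin n → C)) = ⟨2, Q', ![c, d]⟩ →
        ∃ a b, f a = c ∧ f b = d ∧
          (⟨n, Q, v⟩ : Σ n, L.Relations n × (Fin n → B)) = ⟨2, Q', ![a, b]⟩ := by
      intro Q' c d h
      obtain ⟨rfl, h⟩ := Sigma.mk.inj h
      obtain ⟨rfl, h⟩ := Prod.ext_iff.1 (eq_of_heq h)
      refine ⟨v 0, v 1, congrFun h 0, congrFun h 1, ?_⟩
      congr
      funext i
      fin_cases i <;> rfl
    have key' : ∀ (Q' : L.Relations 2) (a b : B),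
        (⟨n, Q, v⟩ : Σ n, L.Relations n × (Fin n → B)) = ⟨2, Q', ![a, b]⟩ →
        (⟨n, Q, (f ∘ v : Fin n → C)⟩ : Σ n, L.Relations n × (Fin n → C)) =
          ⟨2, Q', ![f a, f b]⟩ := by
      intro Q' a b h
      obtain ⟨rfl, h⟩ := Sigma.mk.inj h
      obtain ⟨rfl, h⟩ := Prod.ext_iff.1 (eq_of_heq h)
      dsimp only at h
      subst h
      have h' : (f ∘ ![a, b] : Fin 2 → C) = ![f a, f b] := by
        funext i
        fin_cases i <;> rfl
      rw [h']
    constructor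
    · rintro ⟨c, d, ⟨h, hcd⟩ | ⟨h, hcd⟩⟩
      · obtain ⟨a, b, rfl, rfl, h'⟩ := key _ _ _ h
        exact ⟨a, b, Or.inl ⟨h', f.map_adj_iff.1 hcd⟩⟩
      · obtain ⟨a, b, rfl, rfl, h'⟩ := key _ _ _ h
        exact ⟨a, b, Or.inr ⟨h', (hf _ _).1 hcd⟩⟩
    · rintro ⟨a, b, ⟨h, hab⟩ | ⟨h, hab⟩⟩
      · exact ⟨f a, f b, Or.inl ⟨key' _ _ _ h, f.map_adj_iff.2 hab⟩⟩
      · exact ⟨f a, f b, Or.inr ⟨key' _ _ _ h, (hf _ _).2 hab⟩⟩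

theorem OrderedGraph.mem {K : GraphClass} (hR : R ≠ lt) (hG : K.mem G)
    (hr : IsStrictTotalOrder B r) : (K.orderedExpansion R lt).mem (OrderedGraph R lt G r) := by
  refine ⟨G, fun a b => (relMap_edge hR a b).symm, hG, ?_⟩
  have : (fun a b : OrderedGraph R lt G r => Structure.RelMap lt ![a, b]) = r := by
    funext a b
    exact propext (relMap_lt hR a b)
  rw [this]
  exact hr

theorem OrderedGraph.le {K : GraphClass} (hR : R ≠ lt) {S : Set B} (hS : K.le G S) :
    (K.orderedExpansion R lt).le (OrderedGraph R lt G r) S :=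
  ⟨G, fun a b => (relMap_edge hR a b).symm, hS⟩

end OrderedGraph

/-! ### Stars in generic structures -/

/-- The star with `n` leaves and centre `0`. -/
abbrev finStar (n : ℕ) : SimpleGraph (Fin (n + 1)) := SimpleGraph.starGraph 0

/-- The embedding of the star with one leaf given by an edge of a graph. -/
def edgeEmbedding {V : Type} {G : SimpleGraph V} {a b : V} (h : G.Adj a b) : finStar 1 ↪g G where
  toFun := ![a, b]
  inj' := by
    intro x y
    fin_cases x <;> fin_cases y <;> simp [h.ne, h.ne.symm]
  map_rel_iff' {x y} := by
    change G.Adj (![a, b] x) (![a, b] y) ↔ _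
    fin_cases x <;> fin_cases y <;> simp [h, h.symm]

theorem finStar_adj_zero {n : ℕ} {i : Fin (n + 1)} (hi : i ≠ 0) : (finStar n).Adj 0 i :=
  SimpleGraph.starGraph_center_adj hi.symm

/-- The embedding of the centre. -/
def centreEmbedding (n : ℕ) : finStar 0 ↪g finStar n where
  toFun := fun _ => 0
  inj' := fun a b _ => Subsingleton.elim (α := Fin 1) a b
  map_rel_iff' {a b} := by
    obtain rfl : a = b := Subsingleton.elim (α := Fin 1) a b
    simp

/-- The star with `n` leaves, ordered by the restriction of an order of the natural numbers. -/
abbrev OrderedStar {L : FirstOrder.Language.{0, 0}} (R lt : L.Relations 2) (r : ℕ → ℕ → Prop)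
    (n : ℕ) : Type :=
  OrderedGraph R lt (finStar n) (fun i j => r i j)

section GenericStars

variable {L : FirstOrder.Language.{0, 0}} [L.IsRelational] {R lt : L.Relations 2} {K : GraphClass}
  {N : Type} [L.Structure N] {r : ℕ → ℕ → Prop}

theorem orderedStar_mem (hR : R ≠ lt) (hr : r = (· < ·) ∨ r = (· > ·)) {n : ℕ}
    (hn : K.mem (finStar n)) : (K.orderedExpansion R lt).mem (OrderedStar R lt r n) := by
  refine OrderedGraph.mem hR hn ?_
  rcases hr with rfl | rfl
  · exact inferInstanceAs (IsStrictTotalOrder (Fin (n + 1)) (· < ·))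
  · exact inferInstanceAs (IsStrictTotalOrder (Fin (n + 1)) (· > ·))

/-- The language may have nullary relations, so even the empty substructure embeds into `B` only if
`B` and `N` agree on them; `e` guarantees this. -/
theorem StructureClass.exists_bot_embedding {B : Type} [L.Structure B] (e : B ↪[L] N) :
    Nonempty ((⊥ : L.Substructure N) ↪[L] B) := by
  have hbot : IsEmpty (⊥ : L.Substructure N) := by
    refine ⟨fun x => ?_⟩
    have h : ((⊥ : L.Substructure N) : Set N) = ∅ := by
      rw [← Substructure.closure_empty]
      exact Substructure.closure_eq_of_isRelational L _
    exact (h.subset x.2).elim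
  refine ⟨⟨⟨isEmptyElim, fun x => isEmptyElim x⟩, fun f => isEmptyElim f, ?_⟩⟩
  rintro (_ | n) Q v
  · rw [← e.map_rel, ← (Substructure.subtype (⊥ : L.Substructure N)).map_rel]
    rw [Subsingleton.elim (e ∘ _) ((Substructure.subtype (⊥ : L.Substructure N)) ∘ v)]
  · exact isEmptyElim (v 0)

/-- A closed ordered edge in a generic structure. -/
theorem exists_closed_edge (hK : K.HasClosures) (hN : (K.orderedExpansion R lt).IsGeneric N)
    (hR : R ≠ lt) (hr : r = (· < ·) ∨ r = (· > ·)) (hm : K.mem (finStar 1)) :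
    ∃ h : OrderedStar R lt r 1 ↪[L] N, (K.orderedExpansion R lt).IsClosedIn h.toHom.range := by
  have hmem := orderedStar_mem hR hr hm
  obtain ⟨e⟩ := ((hN.age _).1 hmem).2
  obtain ⟨g⟩ := StructureClass.exists_bot_embedding e
  have hbot : ((⊥ : L.Substructure N) : Set N) = ∅ := by
    rw [← Substructure.closure_empty]
    exact Substructure.closure_eq_of_isRelational L _
  have hfin : Finite (⊥ : L.Substructure N) := Finite.of_injective g g.injective
  have hg : Set.range g = ∅ := by
    rw [Set.eq_empty_iff_forall_notMem]
    rintro _ ⟨x, rfl⟩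
    exact (hbot.subset x.2).elim
  obtain ⟨h, -, hh⟩ := hN.extension ⊥ hfin (hN.isClosedIn_bot hK.orderedExpansion) _ hmem g
    (hg ▸ hK.orderedExpansion.empty_le hmem)
  exact ⟨h, hh⟩

/-- Over a closed vertex of a generic structure there is a closed ordered star. -/
theorem exists_closed_star (hN : (K.orderedExpansion R lt).IsGeneric N)
    (hR : R ≠ lt) (hr : r = (· < ·) ∨ r = (· > ·)) {n : ℕ} (hm : K.mem (finStar n))
    (hle : K.le (finStar n) {0}) {A : L.Substructure N}
    (hA : (K.orderedExpansion R lt).IsClosedIn A) (e : A ↪[L] OrderedStar R lt r n)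
    {a : N} (ha : (A : Set N) = {a}) (he : ∀ x, e x = (0 : Fin (n + 1))) :
    ∃ h : OrderedStar R lt r n ↪[L] N, (K.orderedExpansion R lt).IsClosedIn h.toHom.range ∧
      h (0 : Fin (n + 1)) = a := by
  have haA : a ∈ A := ha.superset rfl
  have hfin : Finite A := Finite.of_injective e e.injective
  have hrange : Set.range e = ({0} : Set (Fin (n + 1))) := by
    ext x
    constructor
    · rintro ⟨y, rfl⟩
      exact he y
    · rintro rfl
      exact ⟨⟨a, haA⟩, he _⟩
  obtain ⟨h, h1, h2⟩ := hN.extension A hfin hA _ (orderedStar_mem hR hr hm) e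
    (by rw [hrange]; exact OrderedGraph.le hR hle)
  exact ⟨h, h2, by rw [← he ⟨a, haA⟩]; exact h1 ⟨a, haA⟩⟩

/-- The centre of a closed edge is the centre of a closed ordered star. -/
theorem exists_closed_star_of_edge (hK : K.HasClosures)
    (hN : (K.orderedExpansion R lt).IsGeneric N) (hR : R ≠ lt) {r' : ℕ → ℕ → Prop}
    (hr : r = (· < ·) ∨ r = (· > ·)) (hr' : r' = (· < ·) ∨ r' = (· > ·)) {n : ℕ}
    (hle : ∀ (n : ℕ) (S : Set (Fin (n + 1))), 0 ∈ S → K.le (finStar n) S)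
    (hm₁ : K.mem (finStar 1)) (hm : K.mem (finStar n)) (h : OrderedStar R lt r 1 ↪[L] N)
    (hh : (K.orderedExpansion R lt).IsClosedIn h.toHom.range) :
    ∃ h' : OrderedStar R lt r' n ↪[L] N, (K.orderedExpansion R lt).IsClosedIn h'.toHom.range ∧
      h' (0 : Fin (n + 1)) = h (0 : Fin 2) := by
  have hirr : ∀ i, ¬ r i i ∧ ¬ r' i i := by
    rcases hr with rfl | rfl <;> rcases hr' with rfl | rfl <;> simp
  -- A single vertex carries no trace of the order, so the same one-point structure is the centre of
  -- the `r`-ordered edge and of the `r'`-ordered star.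
  let c : OrderedStar R lt r 0 ↪[L] OrderedStar R lt r 1 :=
    OrderedGraph.embedding (centreEmbedding 1) (fun a b => by
      obtain rfl : a = b := Subsingleton.elim (α := Fin 1) a b
      exact iff_of_false (hirr _).1 (hirr _).1)
  let c' : OrderedStar R lt r 0 ↪[L] OrderedStar R lt r' n :=
    OrderedGraph.embedding (centreEmbedding n) (fun a b => by
      obtain rfl : a = b := Subsingleton.elim (α := Fin 1) a b
      exact iff_of_false (hirr _).2 (hirr _).1)
  have hA : (((h.comp c).toHom.range : L.Substructure N) : Set N) = {h (0 : Fin 2)} := by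
    ext x
    constructor
    · rintro ⟨y, rfl⟩
      rfl
    · rintro rfl
      exact ⟨(0 : Fin 1), rfl⟩
  refine exists_closed_star hN hR hr' hm (hle n _ rfl) (A := (h.comp c).toHom.range)
    (StructureClass.IsClosedIn.image hN hK.orderedExpansion (orderedStar_mem hR hr hm₁) hh
      (OrderedGraph.le hR (hle 1 {0} rfl)) (hA.trans Set.image_singleton.symm))
    (c'.comp (h.comp c).equivRange.symm.toEmbedding) hA fun x => rfl

/-- The leaves of a closed ordered star are conjugate over its centre. -/
theorem exists_equiv_of_closed_star (hK : K.HasClosures)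
    (hN : (K.orderedExpansion R lt).IsGeneric N) (hR : R ≠ lt)
    (hr : r = (· < ·) ∨ r = (· > ·)) {n : ℕ}
    (hle : ∀ (n : ℕ) (S : Set (Fin (n + 1))), 0 ∈ S → K.le (finStar n) S)
    (hm : K.mem (finStar n)) (h : OrderedStar R lt r 1 ↪[L] N) (h' : OrderedStar R lt r n ↪[L] N)
    (hh : (K.orderedExpansion R lt).IsClosedIn h.toHom.range)
    (hh' : (K.orderedExpansion R lt).IsClosedIn h'.toHom.range) (i : Fin (n + 1)) (hi : i ≠ 0) :
    ∃ g : N ≃[L] N, g (h (0 : Fin 2)) = h' (0 : Fin (n + 1)) ∧ g (h (1 : Fin 2)) = h' i := by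
  have hi' : (i : ℕ) ≠ 0 := fun h => hi (Fin.ext h)
  -- The centre `0` is the least or the greatest vertex for `r`, so every leaf lies on the same side
  -- of it and every edge has the same ordered type.
  let e : OrderedStar R lt r 1 ↪[L] OrderedStar R lt r n :=
    OrderedGraph.embedding (edgeEmbedding (finStar_adj_zero hi)) (fun a b => by
      change r ((![0, i] a : Fin (n + 1)) : ℕ) ((![0, i] b : Fin (n + 1)) : ℕ) ↔ r a b
      rcases hr with rfl | rfl <;> fin_cases a <;> fin_cases b <;>
        simp [Nat.pos_of_ne_zero hi'])
  have hrange : (((h'.comp e).toHom.range : L.Substructure N) : Set N) =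
      h' '' ({0, i} : Set (Fin (n + 1))) := by
    ext x
    constructor
    · rintro ⟨y, rfl⟩
      refine ⟨e y, ?_, rfl⟩
      change (![0, i] : Fin 2 → Fin (n + 1)) y ∈ ({0, i} : Set (Fin (n + 1)))
      change Fin 2 at y
      fin_cases y <;> simp
    · rintro ⟨y, rfl | rfl, rfl⟩
      · exact ⟨(0 : Fin 2), rfl⟩
      · exact ⟨(1 : Fin 2), rfl⟩
  obtain ⟨g, hg⟩ := hN.exists_equiv_comp_eq hK.orderedExpansion h (h'.comp e) hh
    (StructureClass.IsClosedIn.image hN hK.orderedExpansion (orderedStar_mem hR hr hm) hh'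
      (OrderedGraph.le hR (hle n {0, i} (Or.inl rfl))) hrange)
  exact ⟨g, hg (0 : Fin 2), hg (1 : Fin 2)⟩

end GenericStars

/-! ### The contradiction between invariant orientations and stars. -/

section Sparse

variable {L : FirstOrder.Language.{0, 0}} [L.IsRelational] {R lt : L.Relations 2} {K : GraphClass}
  {N : Type} [L.Structure N] {α : ℝ}

/-- The finite induced subgraphs of the graph of a generic structure are in the class. -/
theorem exists_graph_of_isGeneric (hN : (K.orderedExpansion R lt).IsGeneric N) :
    ∃ G : SimpleGraph N, (∀ a b, G.Adj a b ↔ Structure.RelMap R ![a, b]) ∧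
      ∀ S : Set N, S.Finite → K.mem (G.induce S) := by
  have hmem : ∀ S : Set N, S.Finite → ∃ B : L.Substructure N, (B : Set N) = S ∧
      (K.orderedExpansion R lt).mem B := by
    intro S hS
    have hB : ((Substructure.closure L S : L.Substructure N) : Set N) = S :=
      Substructure.closure_eq_of_isRelational L S
    have : Finite (Substructure.closure L S) := by
      rw [← hB] at hS
      exact hS.to_subtype
    exact ⟨_, hB, hN.mem_of_finite _⟩
  have hrel : ∀ (B : L.Substructure N) (a b : B),
      Structure.RelMap R ![a, b] ↔ Structure.RelMap R ![(a : N), (b : N)] := by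
    intro B a b
    rw [← B.subtype.map_rel]
    have h : B.subtype ∘ ![a, b] = ![(a : N), (b : N)] := by
      funext i
      fin_cases i <;> rfl
    rw [h]
  let G : SimpleGraph N :=
    { Adj := fun a b => Structure.RelMap R ![a, b]
      symm := ⟨fun a b hab => by
        obtain ⟨B, hB, H, hH, -⟩ := hmem {a, b} (Set.toFinite _)
        have ha : a ∈ B := hB.superset (Or.inl rfl)
        have hb : b ∈ B := hB.superset (Or.inr rfl)
        have h1 : H.Adj ⟨a, ha⟩ ⟨b, hb⟩ := (hH _ _).2 ((hrel _ _ _).2 hab)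
        exact (hrel _ _ _).1 ((hH _ _).1 h1.symm)⟩
      loopless := ⟨fun a haa => by
        obtain ⟨B, hB, H, hH, -⟩ := hmem {a} (Set.toFinite _)
        have ha : a ∈ B := hB.superset rfl
        exact H.irrefl ((hH ⟨a, ha⟩ ⟨a, ha⟩).2 ((hrel _ _ _).2 haa))⟩ }
  refine ⟨G, fun _ _ => Iff.rfl, fun S hS => ?_⟩
  obtain ⟨B, rfl, H, hH, hHm, -⟩ := hmem S hS
  have : H = G.induce (B : Set N) := by
    ext a b
    rw [hH]
    exact hrel B a b
  exact this ▸ hHm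

/-- If an ordered edge of a class of sparse graphs has arbitrarily many copies over each of its
endpoints, then the flow of orientations of bounded outdegree has no fixed point. -/
theorem not_isExtremelyAmenable_of_star_mem (hplus : ∀ {V : Type} {G : SimpleGraph V}, K.mem G →
      MemPlus α G) (hK : K.HasClosures)
    (hle : ∀ (n : ℕ) (S : Set (Fin (n + 1))), 0 ∈ S → K.le (finStar n) S)
    (hm : ∀ n, K.mem (finStar n)) (hR : R ≠ lt) (hN : (K.orderedExpansion R lt).IsGeneric N) :
    ¬ IsExtremelyAmenable (autGroup L N) := by
  intro hext
  obtain ⟨G, hG, hGm⟩ := exists_graph_of_isGeneric hN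
  let k := ⌈α⌉₊
  obtain ⟨o, ⟨ho, hok⟩, hinv⟩ := exists_invariant_orientation hext (G := G) (k := k) (by
      intro g a b
      have h : g ∘ ![a, b] = ![g a, g b] := by
        funext i
        fin_cases i <;> rfl
      rw [hG, hG, ← h]
      exact g.map_rel R _) (by
      intro S hS
      have h1 := ncard_edgesIn_le ((hplus (hGm S hS)).2 Set.univ)
      rw [← ncard_edgesIn_image (SimpleGraph.Embedding.induce (G := G) S),
        ← Set.ncard_image_of_injective Set.univ Subtype.val_injective] at h1
      have h2 : (SimpleGraph.Embedding.induce (G := G) S : S → N) '' Set.univ = S := by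
        rw [Set.image_univ]; exact Subtype.range_coe
      have h3 : (Subtype.val : S → N) '' Set.univ = S := Set.image_univ.trans Subtype.range_coe
      rw [h2, h3] at h1
      have h4 : ((edgesIn G S).ncard : ℝ) ≤ k * S.ncard :=
        h1.trans (mul_le_mul_of_nonneg_right (Nat.le_ceil α) (Nat.cast_nonneg _))
      exact_mod_cast h4)
  -- No closed edge is directed away from its centre: conjugation would direct all `k + 1` edges of
  -- a closed star away from that vertex.
  have key : ∀ (r : ℕ → ℕ → Prop), r = (· < ·) ∨ r = (· > ·) →
      ∀ h : OrderedStar R lt r 1 ↪[L] N, (K.orderedExpansion R lt).IsClosedIn h.toHom.range →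
      o (h (0 : Fin 2), h (1 : Fin 2)) ≠ true := by
    intro r hr h hh hor
    obtain ⟨h', hh', h0⟩ := exists_closed_star_of_edge hK hN hR hr hr hle (hm 1) (hm (k + 1)) h hh
    have h1 : ∀ i : Fin (k + 1), o (h (0 : Fin 2), h' i.succ) = true := by
      intro i
      obtain ⟨g, hg0, hg1⟩ := exists_equiv_of_closed_star hK hN hR hr hle (hm (k + 1)) h h' hh hh'
        i.succ (Fin.succ_ne_zero i)
      have h2 := hinv g (h (0 : Fin 2)) (h (1 : Fin 2))
      rw [hg0, hg1, h0] at h2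
      exact h2.trans hor
    let s : Finset N := Finset.univ.map
      ((Fin.succEmb (k + 1)).trans h'.toEmbedding)
    have h2 := hok (h (0 : Fin 2)) s fun b hb => by
      obtain ⟨i, -, rfl⟩ := Finset.mem_map.1 hb
      exact h1 i
    rw [Finset.card_map, Finset.card_univ, Fintype.card_fin] at h2
    omega
  obtain ⟨h, hh⟩ := exists_closed_edge (r := (· < ·)) hK hN hR (Or.inl rfl) (hm 1)
  -- If the edge is directed from its upper to its lower endpoint, exchanging the endpoints makes
  -- the upper one the centre, with the order reversed and the closed range unchanged.
  let swap : finStar 1 ≃g finStar 1 :=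
    { toEquiv := Equiv.swap 0 1
      map_rel_iff' := by decide }
  let e : OrderedStar R lt (· > ·) 1 ↪[L] OrderedStar R lt (· < ·) 1 :=
    OrderedGraph.embedding swap.toEmbedding (by decide)
  have hadj : G.Adj (h (0 : Fin 2)) (h (1 : Fin 2)) := by
    have h1 : (finStar 1).Adj 0 1 := by decide
    exact (graphEmbedding (fun a b => (relMap_edge hR a b).symm) hG h).map_adj_iff.2 h1
  rcases ho _ _ hadj with h1 | h1
  · exact key _ (Or.inl rfl) h hh h1
  · have hrange : (h.comp e).toHom.range = h.toHom.range := by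
      ext x
      constructor
      · rintro ⟨y, rfl⟩
        exact ⟨e y, rfl⟩
      · rintro ⟨y, rfl⟩
        exact ⟨swap.symm y, congrArg h (swap.apply_symm_apply y)⟩
    exact key _ (Or.inr rfl) (h.comp e) (hrange ▸ hh) h1

end Sparse

/-! ### Stars in the three kinds of classes -/

/-- For `≤_α` the closure properties come from submodularity and nonnegativity of the predimension,
so smoothness need not be known. -/
theorem hasClosures_of_le_iff {K : GraphClass} {α : ℝ}
    (hplus : ∀ {V : Type} {G : SimpleGraph V}, K.mem G → MemPlus α G)
    (hle : ∀ {V : Type} {G : SimpleGraph V} {S : Set V}, K.le G S ↔ LeAlpha α G S) :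
    K.HasClosures where
  le_univ _ := hle.2 (LeAlpha.univ _)
  empty_le h := hle.2 (LeAlpha.empty (hplus h))
  le_image f _ _ hH h₁ h₂ := hle.2 (have := (hplus hH).1; (hle.1 h₁).image f (hle.1 h₂))
  le_preimage f _ _ _ h := hle.2 ((hle.1 h).preimage f)

section Smooth

variable {K : GraphClass} {V W : Type} {G : SimpleGraph V} {H : SimpleGraph W}

theorem GraphClass.IsSmooth.mem_of_embedding (hK : K.IsSmooth) (f : G ↪g H) (hH : K.mem H) :
    K.mem G :=
  hK.mem_iso f.isoInduceRange.symm (hK.mem_induce _ hH)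

/-- A smooth class with free amalgamation which contains an edge contains all stars. -/
theorem GraphClass.IsSmooth.finStar_mem (hK : K.IsSmooth) (hfree : K.FreeAmalgamation)
    (hle : ∀ n, K.le (finStar n) {0}) (h₁ : K.mem (finStar 1)) (n : ℕ) : K.mem (finStar n) := by
  induction n with
  | zero => exact hK.mem_of_embedding (centreEmbedding 1) h₁
  | succ n ih =>
    -- The larger star is the free amalgam, over the centre, of the smaller star (range of `f`) and
    -- the edge to the last leaf (range of `g`).
    let f : finStar n ↪g finStar (n + 1) :=
      { toFun := Fin.castSucc
        inj' := Fin.castSucc_injective _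
        map_rel_iff' := by simp }
    have hlast : Fin.last (n + 1) ≠ 0 := Fin.last_pos.ne'
    let g : finStar 1 ↪g finStar (n + 1) := edgeEmbedding (finStar_adj_zero hlast)
    have hf : ∀ x, x ∈ Set.range f ↔ x ≠ Fin.last (n + 1) := fun x => Fin.exists_castSucc_eq
    have hg : ∀ x, x ∈ Set.range g ↔ x = 0 ∨ x = Fin.last (n + 1) := by
      intro x
      constructor
      · rintro ⟨y, rfl⟩
        change (![0, Fin.last (n + 1)] : Fin 2 → Fin (n + 2)) y = 0 ∨
          (![0, Fin.last (n + 1)] : Fin 2 → Fin (n + 2)) y = Fin.last (n + 1)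
        fin_cases y <;> simp
      · rintro (rfl | rfl)
        · exact ⟨0, rfl⟩
        · exact ⟨1, rfl⟩
    have hf0 : f.isoInduceRange '' {0} = {x : Set.range f | (x : Fin (n + 2)) ∈ Set.range g} := by
      rw [Set.image_singleton]
      ext x
      rw [Set.mem_singleton_iff, Set.mem_ofPred_eq, hg,
        or_iff_left ((hf _).1 x.2), Subtype.ext_iff]
      rfl
    have hg0 : g.isoInduceRange '' {0} = {x : Set.range g | (x : Fin (n + 2)) ∈ Set.range f} := by
      rw [Set.image_singleton]
      ext x
      rw [Set.mem_singleton_iff, Set.mem_ofPred_eq, hf, Subtype.ext_iff]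
      change (x : Fin (n + 2)) = 0 ↔ _
      rcases (hg _).1 x.2 with h | h <;> simp [h, hlast, hlast.symm]
    refine hfree (finStar (n + 1)) (Set.range f) (Set.range g) ?_ ?_
      (hK.mem_iso f.isoInduceRange ih) (hK.mem_iso g.isoInduceRange h₁)
      (hf0 ▸ hK.le_iso f.isoInduceRange _ ih (hle n))
      (hg0 ▸ hK.le_iso g.isoInduceRange _ h₁ (hle 1))
    · refine Set.eq_univ_of_forall fun x => ?_
      rw [Set.mem_union, hf, hg]
      tauto
    · rintro b ⟨-, hb⟩ c ⟨hc, hc'⟩ hbc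
      rw [hg] at hb hc
      rw [hf, not_not] at hc'
      rcases (SimpleGraph.starGraph_adj.1 hbc).2 with h | h
      · exact hb (Or.inl h)
      · exact hlast (hc'.symm.trans h)

end Smooth

/-! ### Algebraic pairs under embeddings, and the edge as an algebraic pair for `α = 1`. -/

section ZeroAlgebraic

variable {V W : Type} {α : ℝ} {G : SimpleGraph V} {H : SimpleGraph W}

theorem image_ssubset_image_iff {f : W → V} (hf : Function.Injective f) {S T : Set W} :
    f '' S ⊂ f '' T ↔ S ⊂ T := by
  rw [ssubset_iff_subset_not_subset, ssubset_iff_subset_not_subset, Set.image_subset_image_iff hf,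
    Set.image_subset_image_iff hf]

theorem isZeroAlgebraic_image (f : H ↪g G) {A B : Set W} :
    IsZeroAlgebraic α G (f '' A) (f '' B) ↔ IsZeroAlgebraic α H A B := by
  unfold IsZeroAlgebraic
  rw [Set.disjoint_image_iff f.injective, ← Set.image_union, predim_image, predim_image]
  refine and_congr Iff.rfl (and_congr Iff.rfl ⟨fun h B₀ hB₀ hne => ?_, fun h B₀ hB₀ hne => ?_⟩)
  · have h1 := h (f '' B₀) ((image_ssubset_image_iff f.injective).2 hB₀) (hne.image f)
    rwa [← Set.image_union, predim_image] at h1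
  · obtain ⟨B₁, -, rfl⟩ := Set.subset_image_iff.1 hB₀.1
    rw [← Set.image_union, predim_image]
    exact h B₁ ((image_ssubset_image_iff f.injective).1 hB₀) (Set.image_nonempty.1 hne)

theorem isZeroMinAlgebraic_image (f : H ↪g G) {A B : Set W} :
    IsZeroMinAlgebraic α G (f '' A) (f '' B) ↔ IsZeroMinAlgebraic α H A B := by
  unfold IsZeroMinAlgebraic
  rw [isZeroAlgebraic_image]
  refine and_congr Iff.rfl ⟨fun h A₀ hA₀ h0 => ?_, fun h A₀ hA₀ h0 => ?_⟩
  · exact h (f '' A₀) ((image_ssubset_image_iff f.injective).2 hA₀)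
      ((isZeroAlgebraic_image f).2 h0)
  · obtain ⟨A₁, -, rfl⟩ := Set.subset_image_iff.1 hA₀.1
    exact h A₁ ((image_ssubset_image_iff f.injective).1 hA₀) ((isZeroAlgebraic_image f).1 h0)

/-- The empty set is `0`-algebraic over `∅`, which is a proper subset of `A`, so minimality excludes
it. -/
theorem IsZeroMinAlgebraic.nonempty {A B : Set V} (h : IsZeroMinAlgebraic α G A B)
    (hA : A.Nonempty) : B.Nonempty := by
  by_contra hB
  rw [Set.not_nonempty_iff_eq_empty] at hB
  subst hB
  refine h.2 ∅ (Set.empty_ssubset.2 hA) ⟨disjoint_bot_left, by simp, fun B₀ hB₀ => ?_⟩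
  exact (hB₀.2 (Set.empty_subset _)).elim

/-- A `0`-minimally algebraic set gives a pair in the domain of `μ`. -/
theorem IsZeroMinAlgebraic.isMuPair {A B : Set V} (h : IsZeroMinAlgebraic α G A B)
    (hG : MemPlus α G) (hA : A.Nonempty) :
    IsMuPair α (G.induce (A ∪ B)) {x | (x : V) ∈ A} := by
  let f : G.induce (A ∪ B) ↪g G := SimpleGraph.Embedding.induce (A ∪ B)
  have h1 : f '' {x | (x : V) ∈ A} = A := by
    ext x
    exact ⟨by rintro ⟨y, hy, rfl⟩; exact hy, fun hx => ⟨⟨x, Or.inl hx⟩, hx, rfl⟩⟩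
  have h2 : f '' {x | (x : V) ∈ A}ᶜ = B := by
    ext x
    constructor
    · rintro ⟨y, hy, rfl⟩
      exact y.2.resolve_left hy
    · exact fun hx => ⟨⟨x, Or.inr hx⟩, fun hx' => h.1.1.ne_of_mem hx' hx rfl, rfl⟩
  refine ⟨MemPlus.of_embedding f hG, Set.image_nonempty.1 (h1.symm ▸ hA), ?_⟩
  rw [← isZeroMinAlgebraic_image f, h1, h2]
  exact h

/-- For `α = 1` a leaf adds one vertex and one edge over the centre, which cancel; over `∅` it costs
`1`. -/
theorem isZeroMinAlgebraic_edge : IsZeroMinAlgebraic 1 (finStar 1) {0} {1} := by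
  refine ⟨⟨by simp, ?_, fun B₀ hB₀ hne => ?_⟩, fun A₀ hA₀ h => ?_⟩
  · rw [predim_starGraph_of_mem (Set.mem_union_left _ (Set.mem_singleton 0)), predim_starGraph_of_mem (Set.mem_singleton 0)]
    simp
  · exact absurd (Set.ssubset_singleton_iff.1 hB₀) hne.ne_empty
  · rw [Set.ssubset_singleton_iff.1 hA₀] at h
    have h1 := h.2.1
    rw [predim_empty, Set.empty_union, predim_starGraph_of_notMem (by simp)] at h1
    simp at h1

theorem isMuPair_edge : IsMuPair 1 (finStar 1) {0} := by
  refine ⟨memPlus_starGraph le_rfl _, Set.singleton_nonempty _, ?_⟩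
  have : ({0}ᶜ : Set (Fin 2)) = {1} := by
    ext x
    fin_cases x <;> simp
  rw [this]
  exact isZeroMinAlgebraic_edge

theorem IsMuFunction.induce_eq {μ : ∀ {W : Type}, SimpleGraph W → Set W → ℕ}
    (hμ : IsMuFunction α @μ) {A : Set W} (hA : IsMuPair α H A) (f : H ↪g G) {S T : Set V}
    (hS : S = Set.range f) (hT : T = f '' A) : μ (G.induce S) {x | (x : V) ∈ T} = μ H A := by
  subst hS hT
  rw [← hμ.iso f.isoInduceRange A hA]
  congr 1
  ext x
  constructor
  · rintro ⟨y, hy, hyx⟩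
    exact ⟨y, hy, Subtype.ext hyx⟩
  · rintro ⟨y, hy, rfl⟩
    exact ⟨y, hy, rfl⟩

theorem range_edgeEmbedding {a b : V} (h : G.Adj a b) :
    Set.range (edgeEmbedding h) = {a} ∪ {b} := by
  ext x
  constructor
  · rintro ⟨y, rfl⟩
    change Fin 2 at y
    change (![a, b] : Fin 2 → V) y ∈ ({a} ∪ {b} : Set V)
    fin_cases y <;> simp
  · rintro (rfl | rfl)
    · exact ⟨(0 : Fin 2), rfl⟩
    · exact ⟨(1 : Fin 2), rfl⟩

theorem isCopyOver_of_adj {a b c : V} (hb : G.Adj a b) (hc : G.Adj a c) :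
    IsCopyOver G {a} {b} {c} := by
  refine ⟨by simpa using hc.ne, ?_⟩
  have key : ∀ S T : Set V, S = Set.range (edgeEmbedding hb) → T = Set.range (edgeEmbedding hc) →
      ∃ e : G.induce S ≃g G.induce T, ∀ h : a ∈ S, (e ⟨a, h⟩ : V) = a := by
    rintro _ _ rfl rfl
    refine ⟨(edgeEmbedding hb).isoInduceRange.symm.trans (edgeEmbedding hc).isoInduceRange,
      fun h => ?_⟩
    have h1 : (edgeEmbedding hb).isoInduceRange (0 : Fin 2) = ⟨a, h⟩ := rfl
    rw [← h1]
    change (((edgeEmbedding hc).isoInduceRange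
      ((edgeEmbedding hb).isoInduceRange.symm ((edgeEmbedding hb).isoInduceRange 0)) : _) : V) = a
    rw [RelIso.symm_apply_apply]
    rfl
  obtain ⟨e, he⟩ := key _ _ (range_edgeEmbedding hb).symm (range_edgeEmbedding hc).symm
  refine ⟨e, fun x hx => ?_⟩
  obtain rfl : x = a := hx
  exact he _

end ZeroAlgebraic

/-! ### Stars in collapsed classes, and the degenerate case `α = 1`. -/

section Collapsed

variable {α : ℝ} {μ : ∀ {W : Type}, SimpleGraph W → Set W → ℕ}

/-- If `A` contains the centre, each new vertex adds `α - 1`, so an algebraic pair forces `α = 1`,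
and minimality reduces it to one leaf over the centre, with at most `n` disjoint copies. If `A`
misses the centre, every copy must contain it, so disjoint copies number at most one, while `μ ≥
α|A| ≥ 1`. -/
theorem collapsedClass_finStar_mem (hα : 1 ≤ α) (hμ : IsMuFunction α @μ) {n : ℕ}
    (hn : 1 < α ∨ n ≤ μ (finStar 1) {0}) : (collapsedClass α @μ).mem (finStar n) := by
  refine ⟨memPlus_starGraph hα 0, fun A B hA hB 𝒞 hdisj hcopy => ?_⟩
  have hBne := hB.nonempty hA
  have hpair := hB.isMuPair (memPlus_starGraph hα 0) hA
  obtain ⟨⟨hAB, h0, hpos⟩, hmin⟩ := hB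
  have hcard : (A ∪ B).ncard = A.ncard + B.ncard := Set.ncard_union_eq hAB
  have hBpos : (0 : ℝ) < B.ncard := by exact_mod_cast (Set.ncard_pos).2 hBne
  have hcardC : ∀ C ∈ 𝒞, C.ncard = B.ncard := by
    intro C hC
    obtain ⟨hAC, e, -⟩ := hcopy C hC
    have h1 : (A ∪ B).ncard = (A ∪ C).ncard := Nat.card_congr e.toEquiv
    rw [hcard, Set.ncard_union_eq hAC] at h1
    omega
  by_cases hc : (0 : Fin (n + 1)) ∈ A
  · rw [predim_starGraph_of_mem (Set.mem_union_left _ hc), predim_starGraph_of_mem hc, hcard] at h0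
    push_cast at h0
    have hα1 : α = 1 := by
      have h1 : (α - 1) * B.ncard = 0 := by linear_combination h0
      rcases mul_eq_zero.1 h1 with h | h
      · linarith
      · exact absurd h hBpos.ne'
    subst hα1
    obtain ⟨b, hb⟩ := hBne
    obtain rfl : {b} = B := by
      by_contra hne
      have h1 := hpos {b} ((Set.singleton_subset_iff.2 hb).ssubset_of_ne hne)
        (Set.singleton_nonempty b)
      rw [predim_starGraph_of_mem (Set.mem_union_left _ hc), predim_starGraph_of_mem hc] at h1
      simp at h1
    obtain rfl : {0} = A := by
      by_contra hne
      refine hmin {0} ((Set.singleton_subset_iff.2 hc).ssubset_of_ne hne)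
        ⟨hAB.mono_left (Set.singleton_subset_iff.2 hc), ?_, fun B₀ hB₀ hne' => ?_⟩
      · rw [predim_starGraph_of_mem (Set.mem_union_left _ (Set.mem_singleton 0)), predim_starGraph_of_mem (Set.mem_singleton 0)]
        simp
      · exact absurd (Set.ssubset_singleton_iff.1 hB₀) hne'.ne_empty
    have hb0 : b ≠ 0 := fun h => hAB.ne_of_mem rfl rfl h.symm
    have hadj := finStar_adj_zero hb0
    have himage : edgeEmbedding hadj '' {0} = {0} := Set.image_singleton
    rw [hμ.induce_eq isMuPair_edge (edgeEmbedding hadj) (range_edgeEmbedding hadj).symm himage.symm]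
    refine le_trans ?_ (hn.resolve_left (lt_irrefl _))
    have hsub : 𝒞 ⊆ (fun x => {x}) '' ({0}ᶜ : Set (Fin (n + 1))) := by
      intro C hC
      have h1 := hcardC C hC
      rw [Set.ncard_singleton, Set.ncard_eq_one] at h1
      obtain ⟨c, rfl⟩ := h1
      exact ⟨c, fun h => (hcopy _ hC).1.ne_of_mem rfl rfl h.symm, rfl⟩
    refine (Set.ncard_le_ncard hsub).trans ((Set.ncard_image_le).trans ?_)
    rw [Set.ncard_compl, Set.ncard_singleton, Nat.card_eq_fintype_card, Fintype.card_fin]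
    rfl
  · have hmem : ∀ C ∈ 𝒞, (0 : Fin (n + 1)) ∈ C := by
      intro C hC
      by_contra hC0
      obtain ⟨hAC, e, -⟩ := hcopy C hC
      have h1 : predim α (finStar n) (A ∪ C) = predim α (finStar n) (A ∪ B) := by
        have h2 := predim_image (α := α) e.toEmbedding Set.univ
        have h3 : e.toEmbedding '' Set.univ = Set.univ := by
          rw [Set.image_univ]; exact e.surjective.range_eq
        rw [h3, predim_induce, predim_induce, Set.image_univ, Set.image_univ, Subtype.range_coe,
          Subtype.range_coe] at h2
        exact h2
      -- A copy missing the centre would have no edges with `A` or inside itself, and so would raise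
      -- the predimension by `α|B| > 0`.
      rw [← h1, predim_starGraph_of_notMem (fun h => h.elim hc hC0),
        predim_starGraph_of_notMem hc, Set.ncard_union_eq hAC, hcardC C hC] at h0
      push_cast at h0
      have h4 : 0 < α * B.ncard := mul_pos (by linarith) hBpos
      linarith
    have h1 : 𝒞.ncard ≤ 1 := by
      refine (Set.ncard_le_one).2 fun C hC D hD => ?_
      by_contra hne
      exact (hdisj hC hD hne).ne_of_mem (hmem C hC) (hmem D hD) rfl
    have h2 := hμ.predim_le hpair
    rw [predim_induce_setOf Set.subset_union_left, predim_starGraph_of_notMem hc] at h2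
    have h3 : (1 : ℝ) ≤ A.ncard := by exact_mod_cast (Set.ncard_pos).2 hA
    have h4 : (1 : ℝ) ≤ α * A.ncard := one_le_mul_of_one_le_of_one_le hα h3
    have h5 : 1 ≤ μ ((finStar n).induce (A ∪ B)) {x | (x : Fin (n + 1)) ∈ A} := by
      exact_mod_cast h4.trans h2
    exact h1.trans h5

/-- For `α = 1` edges are `0`-algebraic, so that the degrees in the collapsed class are bounded. -/
theorem ncard_le_of_collapsedClass_mem (hμ : IsMuFunction 1 @μ) {V : Type} {G : SimpleGraph V}
    (hG : (collapsedClass 1 @μ).mem G) {a : V} {T : Set V} (hT : ∀ b ∈ T, G.Adj a b) :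
    T.ncard ≤ μ (finStar 1) {0} := by
  rcases T.eq_empty_or_nonempty with rfl | ⟨b, hb⟩
  · simp
  have hadj := hT b hb
  have h0 : edgeEmbedding hadj '' {0} = {a} := Set.image_singleton
  have h1 : edgeEmbedding hadj '' {1} = {b} := Set.image_singleton
  have hmin : IsZeroMinAlgebraic 1 G {a} {b} := by
    rw [← h0, ← h1, isZeroMinAlgebraic_image]
    exact isZeroMinAlgebraic_edge
  have h2 := hG.2 {a} {b} (Set.singleton_nonempty a) hmin ((fun x => {x}) '' T) (by
    rintro _ ⟨x, -, rfl⟩ _ ⟨y, -, rfl⟩ hne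
    exact Set.disjoint_singleton.2 fun h => hne (congrArg _ h)) (by
    rintro _ ⟨c, hc, rfl⟩
    exact isCopyOver_of_adj hadj (hT c hc))
  rwa [Set.ncard_image_of_injective _ Set.singleton_injective,
    hμ.induce_eq isMuPair_edge (edgeEmbedding hadj) (range_edgeEmbedding hadj).symm h0.symm] at h2

/-- For `α = 1` the ordered collapsed class has no generic structure: a closed vertex would have
the greatest possible number of neighbours above it, and a further neighbour below it. -/
theorem not_isGeneric_collapsedClass_one (hμ : IsMuFunction 1 @μ) {L : FirstOrder.Language.{0, 0}}
    [L.IsRelational] {R lt : L.Relations 2} (hR : R ≠ lt) {N : Type} [L.Structure N] :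
    ¬ ((collapsedClass 1 @μ).orderedExpansion R lt).IsGeneric N := by
  intro hN
  have hK : (collapsedClass 1 @μ).HasClosures := hasClosures_of_le_iff (fun h => h.1) Iff.rfl
  have hle : ∀ (n : ℕ) (S : Set (Fin (n + 1))), 0 ∈ S → (collapsedClass 1 @μ).le (finStar n) S :=
    fun n S hS => leAlpha_starGraph le_rfl hS
  set m := μ (finStar 1) {0} with hm
  have hm1 : 1 ≤ m := by
    have h := hμ.predim_le isMuPair_edge
    rw [predim_starGraph_of_mem (Set.mem_singleton 0)] at h
    simpa using h
  have hmem1 : (collapsedClass 1 @μ).mem (finStar 1) :=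
    collapsedClass_finStar_mem le_rfl hμ (Or.inr hm1)
  have hmemm : (collapsedClass 1 @μ).mem (finStar m) :=
    collapsedClass_finStar_mem le_rfl hμ (Or.inr le_rfl)
  obtain ⟨G, hG, hGm⟩ := exists_graph_of_isGeneric hN
  obtain ⟨h, hh⟩ := exists_closed_edge (r := (· < ·)) hK hN hR (Or.inl rfl) hmem1
  obtain ⟨u, -, hu⟩ := exists_closed_star_of_edge (r' := (· < ·)) hK hN hR (Or.inl rfl)
    (Or.inl rfl) hle hmem1 hmemm h hh
  -- The same vertex is the centre of an upward star with `m` leaves and of a downward edge. The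
  -- lower neighbour differs from all upper ones, giving degree at least `m + 1`.
  obtain ⟨d, -, hd⟩ := exists_closed_star_of_edge (r' := (· > ·)) hK hN hR (Or.inl rfl)
    (Or.inr rfl) hle hmem1 hmem1 h hh
  set a := h (0 : Fin 2)
  have hlt : ∀ {B : Type} [L.Structure B] (f : B ↪[L] N) (x y : B),
      Structure.RelMap lt ![f x, f y] ↔ Structure.RelMap lt ![x, y] := by
    intro B _ f x y
    rw [← f.map_rel]
    have h : f ∘ ![x, y] = ![f x, f y] := by
      funext i
      fin_cases i <;> rfl
    rw [h]
  have hnot : ¬ Structure.RelMap lt ![a, d (1 : Fin 2)] := by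
    rw [← hd]
    exact fun h => absurd ((relMap_lt hR _ _).1 ((hlt d _ _).1 h)) (by simp)
  have hup : ∀ i : Fin m, Structure.RelMap lt ![a, u i.succ] := by
    intro i
    rw [← hu]
    exact (hlt u _ _).2 ((relMap_lt hR _ _).2 i.succ_pos)
  have hadj : ∀ b ∈ insert (d (1 : Fin 2)) (Set.range fun i : Fin m => u i.succ), G.Adj a b := by
    rintro _ (rfl | ⟨i, rfl⟩)
    · rw [← hd]
      exact (graphEmbedding (fun a b => (relMap_edge hR a b).symm) hG d).map_adj_iff.2
        (finStar_adj_zero one_ne_zero)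
    · rw [← hu]
      exact (graphEmbedding (fun a b => (relMap_edge hR a b).symm) hG u).map_adj_iff.2
        (finStar_adj_zero (Fin.succ_ne_zero i))
  have hcard : (insert (d (1 : Fin 2)) (Set.range fun i : Fin m => u i.succ)).ncard = m + 1 := by
    rw [Set.ncard_insert_of_notMem]
    · have hinj : Function.Injective fun i : Fin m => u i.succ :=
        u.injective.comp (Fin.succ_injective m)
      rw [← Set.image_univ, Set.ncard_image_of_injective _ hinj, Set.ncard_univ,
        Nat.card_eq_fintype_card, Fintype.card_fin]
    · rintro ⟨i, hi⟩
      exact hnot (hi ▸ hup i)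
  generalize insert (d (1 : Fin 2)) (Set.range fun i : Fin m => u i.succ) = T at hadj hcard
  have hT : T.Finite := Set.finite_of_ncard_pos (by omega)
  have h1 := ncard_le_of_collapsedClass_mem hμ (hGm _ (hT.insert a))
    (a := ⟨a, Or.inl rfl⟩) (T := {x | (x : N) ∈ T}) fun b hb => hadj b hb
  have h2 : (Subtype.val : ↥(insert a T : Set N) → N) '' {x | (x : N) ∈ T} = T := by
    ext x
    exact ⟨by rintro ⟨y, hy, rfl⟩; exact hy, fun hx => ⟨⟨x, Or.inr hx⟩, hx, rfl⟩⟩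
  rw [← Set.ncard_image_of_injective _ Subtype.val_injective, h2, hcard, ← hm] at h1
  omega

end Collapsed

/-! ### The three classes. -/

theorem mainTheorem3 (α : ℝ) (hα : 1 ≤ α) (K : GraphClass)
    (hK : K = abInitioClass α ∨
      (∃ (q : ℚ) (μ : ∀ {W : Type}, SimpleGraph W → Set W → ℕ),
        α = (q : ℝ) ∧ IsMuFunction α @μ ∧ K = collapsedClass α @μ) ∨
      (∃ f : ℝ≥0 → ℝ≥0, IsNondegenerateGood α f ∧ K = controlledClass α f))
    (L : FirstOrder.Language.{0, 0}) [L.IsRelational] [Finite L.Symbols] (R lt : L.Relations 2) (hR : R ≠ lt)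
    (N : Type) [L.Structure N] (hN : (K.orderedExpansion R lt).IsGeneric N) :
    ¬ IsExtremelyAmenable (autGroup L N) := by
  rcases hK with rfl | ⟨q, μ, -, hμ, rfl⟩ | ⟨f, hf, rfl⟩
  · exact not_isExtremelyAmenable_of_star_mem (K := abInitioClass α) (α := α) (fun h => h)
      (hasClosures_of_le_iff (α := α) (fun h => h) Iff.rfl) (fun n S hS => leAlpha_starGraph hα hS)
      (fun n => memPlus_starGraph hα 0) hR hN
  · rcases hα.eq_or_lt with rfl | hα'
    -- Here the statement is vacuous: no ordered generic structure exists.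
    · exact absurd hN (not_isGeneric_collapsedClass_one hμ hR)
    · exact not_isExtremelyAmenable_of_star_mem (K := collapsedClass α @μ) (α := α) (fun h => h.1)
        (hasClosures_of_le_iff (α := α) (fun h => h.1) Iff.rfl) (fun n S hS => leAlpha_starGraph hα hS)
        (fun n => collapsedClass_finStar_mem hα hμ (Or.inl hα')) hR hN
  · have hle : ∀ (n : ℕ) (S : Set (Fin (n + 1))), 0 ∈ S → (controlledClass α f).le (finStar n) S :=
      fun n S hS => ltAlpha_starGraph hf.one_lt hS
    obtain ⟨V, G, hG, hne⟩ := hf.exists_edge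
    obtain ⟨a, b, hab⟩ := SimpleGraph.ne_bot_iff_exists_adj.1 hne
    exact not_isExtremelyAmenable_of_star_mem (K := controlledClass α f) (α := α)
      (fun h => h.1) hf.smooth.hasClosures hle
      (hf.smooth.finStar_mem hf.free (fun n => hle n _ rfl)
        (hf.smooth.mem_of_embedding (edgeEmbedding hab) hG)) hR hN
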